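/- Let $d\ge 1$, let $\|\cdot\|$ be the Euclidean norm on $\mathbb{R}^d$, let $\Theta=\{\mathbf z\in\mathbb{R}^d:\|\mathbf z\|=1\}$, and let $\lambda$ be the surface area measure on $\Theta$. Let $\mathbf X_1,\mathbf X_2,\dots$ be i.i.d. copies of a random vector $\mathbf X$ in $\mathbb{R}^d$ whose distribution has a continuous density $f$ with $f>0$ everywhere. Suppose that for some $\alpha>0$, some positive function $V$ that is regularly varying at infinity with index $-\alpha$ (that is, $V(tx)/V(t)\to x^{-\alpha}$ as $t\to\infty$ for every $x>0$) and some positive function $q$ on $\mathbb{R}^d\setminus\{\mathbf 0\}$, $$\lim_{t\to\infty}\frac{f(t\mathbf z)}{t^{-d}V(t)}=q(\mathbf z)\ \text{ for all }\mathbf z\ne\mathbf 0,\qquad \lim_{t\to\infty}\sup_{\mathbf z\in\Theta}\Bigl|\frac{f(t\mathbf z)}{t^{-d}V(t)}-q(\mathbf z)\Bigr|=0 .$$ Then $\mathbf X$ has a (unique) spectral density $\psi$, that is, a continuous function $\psi\ge 0$ on $\Theta$ such that $\Psi(A)=\int_A\psi\,d\lambda$ is a probability measure on $\Theta$ with $$\lim_{t\to\infty}\frac{\mathbb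 P(\|\mathbf X\|\ge tx,\ \mathbf X/\|\mathbf X\|\in A)}{\mathbb P(\|\mathbf X\|\ge t)}=x^{-\alpha}\Psi(A)$$ for all $x>0$ and all Borel sets $A\subset\Theta$ with $\Psi(\partial A)=0$, and such that $$\lim_{t\to\infty}\frac{f(tr\mathbf w)}{t^{-d}\,\mathbb P(\|\mathbf X\|>t)}=\alpha r^{-\alpha-d}\psi(\mathbf w)\quad\text{for all } r>0,\ \mathbf w\in\Theta .$$ Let $K:[0,1]\to[0,1]$ be continuous and nonincreasing with $K(0)=1$ and $K(1)=0$, and put $K(u)=0$ for $u>1$. For $0<h<1$ and $\mathbf w\in\Theta$ let $C_{\mathbf w}(h)=\{\mathbf v\in\Theta:\mathbf w^T\mathbf v\ge 1-h\}$ and $$c(h,K)=\Bigl(\int_{C_{\mathbf w}(h)}K\Bigl(\frac{1-\mathbf v^T\mathbf w}{h}\Bigr)\,d\lambda(\mathbf v)\Bigr)^{-1},$$ which does not depend on $\mathbf w$. Let $k=k_n$ be integers with $k\to\infty$ and $k/n\to 0$, and let $h=h_n\in(0,1)$, with $h\to 0$ and $k/(c(h,K)\log k)\to\infty$ as $n\to\infty$.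 Write $R_i=\|\mathbf X_i\|$, $\mathbf W_i=\mathbf X_i/\|\mathbf X_i\|$, let $R_{1:n}\le\dots\le R_{n:n}$ be the order statistics of $R_1,\dots,R_n$, and let $$\widehat\psi_n(\mathbf w)=\frac{c(h,K)}{k}\sum_{i=1}^nK\Bigl(\frac{1-\mathbf w^T\mathbf W_i}{h}\Bigr)\mathbf 1_{[R_i>R_{n-k:n}]},\qquad \mathbf w\in\Theta .$$ Then, as $n\to\infty$, $$\sup_{\mathbf w\in\Theta}\bigl|\widehat\psi_n(\mathbf w)-\psi(\mathbf w)\bigr|\ \to\ 0\quad\text{in probability.}$$ -/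

import Mathlib

open MeasureTheory ProbabilityTheory Filter Topology
open scoped ENNReal RealInnerProductSpace

/-- The space `ℝᵈ` with the Euclidean (`L₂`) norm. -/
abbrev RSpace (d : ℕ) : Type := EuclideanSpace ℝ (Fin d)

/-- The unit sphere `Θ` of `ℝᵈ`. -/
abbrev Theta (d : ℕ) : Type := Metric.sphere (0 : RSpace d) 1

/-- The surface area measure `λ` on the unit sphere, normalised as in the polar coordinates
formula `dz = r ^ (d - 1) dr dλ(w)` for `z = r w`. -/
noncomputable abbrev surfaceArea (d : ℕ) : Measure (Theta d) :=
  (volume : Measure (RSpace d)).toSphere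

/-- A function `V : (0, ∞) → ℝ`, given as a function on `ℝ`, varies regularly at infinity with
index `ρ`. -/
def RegularlyVaryingAtTop (V : ℝ → ℝ) (ρ : ℝ) : Prop :=
  ∀ x : ℝ, 0 < x → Tendsto (fun t : ℝ => V (t * x) / V t) atTop (𝓝 (x ^ ρ))

/-- The function `f`, to be used as the density of a random vector in `ℝᵈ`, is continuous and
positive, and for a positive function `V` that varies regularly at infinity with index `-α` and a
positive function `q` on `ℝᵈ \ {0}` one has `f (t z) / (t ^ (-d) V t) → q z` as `t → ∞`, for every
`z ≠ 0` and uniformly for `z` in the unit sphere. -/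
structure DensityRegularVariation {d : ℕ} (f : RSpace d → ℝ) (α : ℝ) (q : RSpace d → ℝ)
    (V : ℝ → ℝ) : Prop where
  continuous_density : Continuous f
  density_pos : ∀ z, 0 < f z
  q_pos : ∀ z, z ≠ 0 → 0 < q z
  V_pos : ∀ t, 0 < t → 0 < V t
  V_regularlyVarying : RegularlyVaryingAtTop V (-α)
  tendsto_pointwise : ∀ z, z ≠ 0 →
    Tendsto (fun t : ℝ => f (t • z) / (t ^ (-(d : ℝ)) * V t)) atTop (𝓝 (q z))
  tendsto_uniformly :
    TendstoUniformlyOn (fun (t : ℝ) (z : RSpace d) => f (t • z) / (t ^ (-(d : ℝ)) * V t)) q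
      atTop (Metric.sphere 0 1)

/-- The probability measure `Ψ` on the unit sphere is the spectral measure, with index `α`, of a
random vector with law `μ`: the law is multivariate regularly varying, that is,
`P(‖X‖ ≥ t x, X / ‖X‖ ∈ A) / P(‖X‖ ≥ t) → x ^ (-α) Ψ(A)` as `t → ∞` for every `x > 0` and every
Borel set `A` of the sphere with `Ψ(∂A) = 0`. -/
structure IsSpectralMeasure {d : ℕ} (μ : Measure (RSpace d)) (α : ℝ)
    (Ψ : Measure (Theta d)) : Prop where
  isProbabilityMeasure : IsProbabilityMeasure Ψ
  tendsto : ∀ x : ℝ, 0 < x → ∀ A : Set (Theta d), MeasurableSet A → Ψ (frontier A) = 0 →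
    Tendsto (fun t : ℝ =>
        μ.real {z | t * x ≤ ‖z‖ ∧ ‖z‖⁻¹ • z ∈ Subtype.val '' A} / μ.real {z | t ≤ ‖z‖})
      atTop (𝓝 (x ^ (-α) * Ψ.real A))

/-- The function `ψ` on the unit sphere is the spectral density, with index `α`, of a random vector
with law `μ` and density `f`: it is the continuous density, with respect to surface area, of the
spectral measure, and it is tied to `f` by the limit relation
`f (t r w) / (t ^ (-d) P(‖X‖ > t)) → q (r w) = α r ^ (-α - d) ψ w` as `t → ∞`, for `r > 0` and `w`
in the sphere. This last relation, for `r = 1`, determines `ψ` uniquely when `α ≠ 0`. -/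
structure IsSpectralDensity {d : ℕ} (μ : Measure (RSpace d)) (f : RSpace d → ℝ) (α : ℝ)
    (ψ : Theta d → ℝ) : Prop where
  continuous : Continuous ψ
  nonneg : ∀ w, 0 ≤ ψ w
  isSpectralMeasure : IsSpectralMeasure μ α
    ((surfaceArea d).withDensity fun w => ENNReal.ofReal (ψ w))
  tendsto_density : ∀ (r : ℝ) (w : Theta d), 0 < r →
    Tendsto (fun t : ℝ =>
        f (t • (r • (w : RSpace d))) / (t ^ (-(d : ℝ)) * μ.real {z | t < ‖z‖}))
      atTop (𝓝 (α * r ^ (-α - d) * ψ w))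

/-- The value at `u` of a kernel `K : [0,1] → [0,1]`, extended to the real line by its values at
the end points: by `K 1` (which is `0`) to the right of `1` and by `K 0` (which is `1`) to the left
of `0`. -/
noncomputable def kernelValue (K : unitInterval → unitInterval) (u : ℝ) : ℝ :=
  (Set.IccExtend zero_le_one K u : unitInterval)

/-- The spherical cap `C_w(h) = {v ∈ Θ : wᵀv ≥ 1 - h}`. -/
def sphericalCap {d : ℕ} (w : Theta d) (h : ℝ) : Set (Theta d) :=
  {v | 1 - h ≤ ⟪(w : RSpace d), (v : RSpace d)⟫}

/-- The normalising constant `c(h, K)`, the inverse of the integral of `K ((1 - vᵀw) / h)` over the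
cap `C_w(h)`. It does not depend on `w`, see `kernelConst_eq`. -/
noncomputable def kernelConst {d : ℕ} (h : ℝ) (K : unitInterval → unitInterval) (w : Theta d) : ℝ :=
  (∫ v in sphericalCap w h, kernelValue K ((1 - ⟪(v : RSpace d), (w : RSpace d)⟫) / h)
    ∂(surfaceArea d))⁻¹

open scoped Pointwise in
/-- A linear isometry preserves the surface area of the unit sphere. -/
theorem measurePreserving_sphere {d : ℕ} (e : RSpace d ≃ₗᵢ[ℝ] RSpace d) :
    MeasurePreserving
      (fun v : Theta d => (⟨e v, by simp⟩ : Theta d)) (surfaceArea d) (surfaceArea d) := by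
  have hm : Measurable (fun v : Theta d => (⟨e v, by simp⟩ : Theta d)) :=
    Measurable.subtype_mk (e.continuous.measurable.comp measurable_subtype_coe)
  refine ⟨hm, ?_⟩
  ext s hs
  rw [Measure.map_apply hm hs, Measure.toSphere_apply' _ hs, Measure.toSphere_apply' _ (hm hs)]
  congr 1
  rw [← (e.measurePreserving).measure_preimage_emb e.toHomeomorph.measurableEmbedding
    (Set.Ioo (0 : ℝ) 1 • (Subtype.val '' s))]
  congr 1
  ext x
  simp only [Set.mem_smul, Set.mem_image, Set.mem_preimage, Subtype.exists]
  constructor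
  · rintro ⟨r, hr, y, ⟨a, ha, has, rfl⟩, rfl⟩
    exact ⟨r, hr, e a, ⟨e a, by simpa using ha, has, rfl⟩, (map_smul e r a).symm⟩
  · rintro ⟨r, hr, y, ⟨a, ha, has, rfl⟩, hx⟩
    refine ⟨r, hr, e.symm a, ⟨e.symm a, by simpa using ha, by simpa using has, rfl⟩, ?_⟩
    apply e.injective
    rw [map_smul]
    simpa using hx

/-- The constant `c(h, K)` does not depend on the centre of the cap. -/
theorem kernelConst_eq {d : ℕ} (h : ℝ) (K : unitInterval → unitInterval) (w w' : Theta d) :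
    kernelConst h K w = kernelConst h K w' := by
  obtain ⟨e, he⟩ : ∃ e : RSpace d ≃ₗᵢ[ℝ] RSpace d, e w = w' :=
    ⟨_, Submodule.reflection_sub (v := (w : RSpace d)) (w := (w' : RSpace d)) (by simp)⟩
  unfold kernelConst
  congr 1
  have hme : MeasurableEmbedding (fun v : Theta d => (⟨e v, by simp⟩ : Theta d)) := by
    refine Topology.IsClosedEmbedding.measurableEmbedding ?_
    refine Continuous.isClosedEmbedding ?_ ?_
    · exact Continuous.subtype_mk (e.continuous.comp continuous_subtype_val) _
    · intro a b hab
      exact Subtype.ext (e.injective (congrArg Subtype.val hab))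
  symm
  rw [← (measurePreserving_sphere e).setIntegral_preimage_emb hme]
  have h1 : (fun v : Theta d => (⟨e v, by simp⟩ : Theta d)) ⁻¹' sphericalCap w' h =
      sphericalCap w h := by
    ext v
    change 1 - h ≤ ⟪(w' : RSpace d), e v⟫ ↔ 1 - h ≤ ⟪(w : RSpace d), (v : RSpace d)⟫
    rw [← he, e.inner_map_map]
  rw [h1]
  congr 1
  ext v
  rw [← he, e.inner_map_map]

/-- The `m`-th order statistic `R_{m:n}` of `R₁, …, Rₙ`, with
`R_{1:n} ≤ R_{2:n} ≤ … ≤ R_{n:n}`; the value is `0` if not `1 ≤ m ≤ n`. -/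
noncomputable def orderStatistic {n : ℕ} (R : Fin n → ℝ) (m : ℕ) : ℝ :=
  if hm : 1 ≤ m ∧ m ≤ n then R (Tuple.sort R ⟨m - 1, by omega⟩) else 0

/-- The kernel estimator `ψ̂ₙ(w)` of the spectral density at `w`, computed from the observations
`x₁, …, xₙ` with radii `Rᵢ = ‖xᵢ‖` and directions `Wᵢ = xᵢ / ‖xᵢ‖`. -/
noncomputable def spectralEstimator {d n : ℕ} (k : ℕ) (h : ℝ) (K : unitInterval → unitInterval)
    (x : Fin n → RSpace d) (w : Theta d) : ℝ :=
  kernelConst h K w / k *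
    ∑ i, kernelValue K ((1 - ⟪(w : RSpace d), ‖x i‖⁻¹ • x i⟫) / h) *
      (if orderStatistic (fun j => ‖x j‖) (n - k) < ‖x i‖ then 1 else 0)

/-! Write g(r) for `sphereIntegral f r`, G(s) for P(‖X‖ > s), c for c(h, K) and m = k / c.

Uniform regular variation says that f(rv) = (ψ(v) + o(1)) g(r) as r → ∞, uniformly in v ∈ Θ, where ψ
is q normalised to have integral one over Θ. In polar coordinates this makes the direction, given a
large radius, asymptotically distributed with density ψ. Karamata's theorem for r^d g(r) compares g
with G, and so identifies ψ as the spectral density.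

For consistency, replace the random threshold by a deterministic s with n G(s) = θ k
(`exists_threshold`). The kernel sum over the exceedances of s has mean (θ ψ(w) + o(1)) m uniformly
in w (`eventually_abs_mean_sub_le`). Its summands lie in [0, 1], so a Chernoff bound whose quadratic
term is governed by the mean gives deviations of order m probability at most 2 exp(-κ m)
(`exists_exceedance_concentration`). Since k / (c log k) → ∞, this beats every power of c, while a
grid of mesh proportional to h needs only O(c^(2d)) points (`exists_grid`). Between grid points the
kernel sum changes by a small multiple of the number of exceedances with direction in a cap of
height 2h, and that number is O(m) because surface area is doubling. A union bound over the grid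
yields uniformity in w.

Finally take θ = 1 + η and θ = 1 - η. The numbers of exceedances concentrate near θ k, so the order
statistic is trapped between the two thresholds; kernel sums decrease in the threshold, so the
estimator is squeezed up to a bias η ψ. -/

/-! ### Regular variation on the half-line: uniform convergence and Karamata's theorem. -/

/-- The uniform convergence theorem of Karamata, in additive form, for continuous functions. -/
theorem exists_forall_abs_add_sub_le {k : ℝ → ℝ} (hk : Continuous k)
    (hlim : ∀ u, Tendsto (fun x => k (x + u) - k x) atTop (𝓝 0)) {ε : ℝ} (hε : 0 < ε) :
    ∃ N, ∀ x ≥ N, ∀ u ∈ Set.Icc (0 : ℝ) 1, |k (x + u) - k x| ≤ ε := by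
  set δ := ε / 3 with hδ
  have hδ0 : 0 < δ := by positivity
  -- Baire category: the closed sets `E N` cover the line, so on some ball about a point `a` the
  -- convergence is uniform.
  let E : ℕ → Set ℝ := fun N => {u | ∀ x : ℝ, (N : ℝ) ≤ x → |k (x + u) - k x| ≤ δ}
  have hE : ∀ N, IsClosed (E N) := by
    intro N
    simp only [E, Set.ofPred_forall]
    refine isClosed_iInter fun x => isClosed_iInter fun _ => ?_
    exact isClosed_le (by fun_prop) continuous_const
  have hcov : ⋃ N, E N = Set.univ := by
    refine Set.eq_univ_of_forall fun u => ?_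
    have h := (Metric.tendsto_atTop.1 (hlim u)) δ hδ0
    obtain ⟨N, hN⟩ := h
    refine Set.mem_iUnion.2 ⟨⌈N⌉₊, fun x hx => ?_⟩
    have := hN x ((Nat.le_ceil N).trans hx)
    rw [Real.dist_eq, sub_zero] at this
    exact this.le
  obtain ⟨N, a, ha⟩ := nonempty_interior_of_iUnion_of_closed hE hcov
  obtain ⟨r, hr, hball⟩ := Metric.isOpen_iff.1 isOpen_interior a ha
  have hsub : Metric.ball a r ⊆ E N := hball.trans interior_subset
  -- Subtracting the bounds for `a + v` and `a`, both at the point x - a, moves the uniformity from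
  -- a ball about `a` to a ball about 0 and doubles the error. Finitely many translates of that ball
  -- then cover [0, 1].
  have hsmall : ∀ v, |v| < r → ∀ x, (N : ℝ) + a ≤ x → |k (x + v) - k x| ≤ 2 * δ := by
    intro v hv x hx
    have h1 : a + v ∈ E N := hsub (by simpa [Real.dist_eq] using hv)
    have h2 : a ∈ E N := hsub (Metric.mem_ball_self hr)
    have h3 := h1 (x - a) (by linarith)
    have h4 := h2 (x - a) (by linarith)
    rw [show x - a + (a + v) = x + v by ring] at h3
    rw [show x - a + a = x by ring] at h4
    rw [abs_le] at *
    constructor <;> linarith [h3.1, h3.2, h4.1, h4.2]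
  obtain ⟨t, -, htf, ht⟩ := (isCompact_Icc (a := (0 : ℝ)) (b := 1)).elim_finite_subcover_image
    (b := Set.univ) (c := fun u => Metric.ball u r) (fun _ _ => Metric.isOpen_ball)
    (fun u _ => Set.mem_iUnion₂.2 ⟨u, trivial, Metric.mem_ball_self hr⟩)
  have hev : ∀ᶠ x in atTop, ∀ u ∈ t, |k (x + u) - k x| ≤ δ := by
    rw [Filter.eventually_all_finite htf]
    intro u _
    have h := (Metric.tendsto_nhds.1 (hlim u)) δ hδ0
    filter_upwards [h] with x hx
    rw [Real.dist_eq, sub_zero] at hx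
    exact hx.le
  have hev2 : ∀ᶠ x in atTop, ∀ u ∈ t, (N : ℝ) + a ≤ x + u := by
    rw [Filter.eventually_all_finite htf]
    intro u _
    filter_upwards [eventually_ge_atTop ((N : ℝ) + a - u)] with x hx
    linarith
  obtain ⟨M, hM⟩ := eventually_atTop.1 (hev.and hev2)
  refine ⟨M, fun x hx u hu => ?_⟩
  obtain ⟨u', hu't, hu'⟩ := Set.mem_iUnion₂.1 (ht hu)
  have h1 := (hM x hx).1 u' hu't
  have h2 := hsmall (u - u') (by simpa [Real.dist_eq] using hu') (x + u') ((hM x hx).2 u' hu't)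
  rw [show x + u' + (u - u') = x + u by ring] at h2
  rw [abs_le] at *
  constructor <;> linarith [h1.1, h1.2, h2.1, h2.2]

section Karamata

variable {U : ℝ → ℝ} {α : ℝ}

/-- Uniform convergence on compact intervals for regularly varying functions. -/
theorem RegularlyVaryingAtTop.eventually_abs_sub_le (hU : ContinuousOn U (Set.Ioi 0))
    (hpos : ∀ r, 0 < r → 0 < U r) (hRV : RegularlyVaryingAtTop U (-α)) (hα : 0 < α)
    {ε : ℝ} (hε : 0 < ε) :
    ∀ᶠ t in atTop, ∀ r ∈ Set.Icc t (Real.exp 1 * t),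
      |U r - U t * (r / t) ^ (-α)| ≤ ε * U t := by
  -- In logarithmic coordinates, with the factor of index -α removed, regular variation reads k(x +
  -- u) - k(x) → 0, and r ∈ [t, e t] becomes u ∈ [0, 1].
  let k : ℝ → ℝ := fun x => Real.log (U (Real.exp x)) + α * x
  have hk : Continuous k := by
    have : Continuous fun x => U (Real.exp x) :=
      hU.comp_continuous Real.continuous_exp fun x => Real.exp_pos x
    exact (this.log fun x => (hpos _ (Real.exp_pos x)).ne').add (by fun_prop)
  have hlim : ∀ u, Tendsto (fun x => k (x + u) - k x) atTop (𝓝 0) := by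
    intro u
    have h1 := (hRV (Real.exp u) (Real.exp_pos u)).comp Real.tendsto_exp_atTop
    have h2 := (h1.log (Real.rpow_pos_of_pos (Real.exp_pos u) _).ne').add_const (α * u)
    rw [Real.log_rpow (Real.exp_pos u), Real.log_exp] at h2
    rw [show -α * u + α * u = 0 by ring] at h2
    refine h2.congr fun x => ?_
    simp only [k, Function.comp]
    rw [Real.log_div (hpos _ (by positivity)).ne' (hpos _ (by positivity)).ne', Real.exp_add]
    ring
  obtain ⟨η, hη0, hη⟩ : ∃ η > 0, ∀ y : ℝ, |y| ≤ η → |Real.exp y - 1| ≤ ε := by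
    have hc : ContinuousAt (fun y => Real.exp y) 0 := Real.continuous_exp.continuousAt
    obtain ⟨η, hη, h⟩ := Metric.continuousAt_iff.1 hc ε hε
    refine ⟨η / 2, by positivity, fun y hy => ?_⟩
    have := h (x := y) (by rw [Real.dist_eq, sub_zero]; linarith)
    rw [Real.exp_zero, Real.dist_eq] at this
    exact this.le
  obtain ⟨N, hN⟩ := exists_forall_abs_add_sub_le hk hlim hη0
  filter_upwards [eventually_ge_atTop (Real.exp N)] with t ht r hr
  have ht0 : 0 < t := (Real.exp_pos N).trans_le ht
  have hr0 : 0 < r := ht0.trans_le hr.1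
  have hs : 0 < r / t := by positivity
  have hkey := hN (Real.log t) ((Real.le_log_iff_exp_le ht0).2 ht) (Real.log (r / t))
    ⟨Real.log_nonneg ((one_le_div ht0).2 hr.1), by
      rw [Real.log_le_iff_le_exp hs, div_le_iff₀ ht0]; exact hr.2⟩
  have hadd : Real.log t + Real.log (r / t) = Real.log r := by
    rw [← Real.log_mul ht0.ne' hs.ne', mul_div_cancel₀ _ ht0.ne']
  have hval : k (Real.log t + Real.log (r / t)) - k (Real.log t)
      = Real.log (U r) - Real.log (U t) + α * Real.log (r / t) := by
    simp only [k, hadd]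
    rw [Real.exp_log hr0, Real.exp_log ht0, ← hadd]
    ring
  rw [hval] at hkey
  have h := hη _ hkey
  have hexp : Real.exp (Real.log (U r) - Real.log (U t) + α * Real.log (r / t))
      = U r / U t * (r / t) ^ α := by
    rw [Real.exp_add, Real.exp_sub, Real.exp_log (hpos r hr0), Real.exp_log (hpos t ht0),
      Real.rpow_def_of_pos hs, mul_comm α]
  rw [hexp] at h
  -- For r ≥ t the power is at most 1, which turns the relative error into a multiple of U(t).
  have hone : (r / t) ^ (-α) ≤ 1 :=
    Real.rpow_le_one_of_one_le_of_nonpos ((one_le_div ht0).2 hr.1) (by linarith)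
  have hp : 0 < (r / t) ^ (-α) := Real.rpow_pos_of_pos hs _
  have hUt := hpos t ht0
  have heq : U r - U t * (r / t) ^ (-α)
      = (U r / U t * (r / t) ^ α - 1) * (U t * (r / t) ^ (-α)) := by
    have : (r / t) ^ α * (r / t) ^ (-α) = 1 := by rw [← Real.rpow_add hs]; simp
    field_simp
    linear_combination (-U r) * this
  rw [heq, abs_mul, abs_of_pos (mul_pos hUt hp)]
  refine mul_le_mul h ?_ (by positivity) hε.le
  nlinarith

/-- The tail integral of a regularly varying function is regularly varying. -/
theorem RegularlyVaryingAtTop.tendsto_tail_ratio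
    (hpos : ∀ r, 0 < r → 0 < U r) (hRV : RegularlyVaryingAtTop U (-α))
    (hint : ∀ a, 0 < a → IntegrableOn (fun r => U r / r) (Set.Ioi a)) {x : ℝ} (hx : 0 < x) :
    Tendsto (fun t => (∫ r in Set.Ioi (t * x), U r / r) / ∫ r in Set.Ioi t, U r / r) atTop
      (𝓝 (x ^ (-α))) := by
  have hTpos : ∀ t, 0 < t → 0 < ∫ r in Set.Ioi t, U r / r := by
    intro t ht
    rw [setIntegral_pos_iff_support_of_nonneg_ae]
    · have : Set.Ioi t ⊆ Function.support fun r => U r / r := fun r (hr : t < r) =>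
        (div_pos (hpos r (ht.trans hr)) (ht.trans hr)).ne'
      rw [Set.inter_eq_self_of_subset_right this]
      simp
    · filter_upwards [ae_restrict_mem measurableSet_Ioi] with r (hr : t < r)
      exact (div_pos (hpos r (ht.trans hr)) (ht.trans hr)).le
    · exact hint t ht
  rw [Metric.tendsto_nhds]
  intro ε hε
  have hev := (Metric.tendsto_nhds.1 (hRV x hx)) (ε / 2) (by positivity)
  obtain ⟨N, hN⟩ := eventually_atTop.1 hev
  filter_upwards [eventually_ge_atTop N, eventually_gt_atTop 0] with t htN ht0
  -- The measure dr / r is invariant under scaling, so both tails become integrals over (t, ∞), and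
  -- the pointwise comparison of U(rx) with x^(-α) U(r) can be integrated.
  have hsub : ∫ r in Set.Ioi (t * x), U r / r = ∫ r in Set.Ioi t, U (r * x) / r := by
    have := integral_comp_mul_right_Ioi (fun r => U r / r) t hx
    rw [smul_eq_mul, eq_inv_mul_iff_mul_eq₀ hx.ne', ← integral_const_mul] at this
    rw [← this]
    refine setIntegral_congr_fun measurableSet_Ioi fun r (hr : t < r) => ?_
    have : 0 < r := ht0.trans hr
    field_simp
  have hI : IntegrableOn (fun r => U (r * x) / r) (Set.Ioi t) := by
    have h1 := (integrableOn_Ioi_comp_mul_right_iff (fun r => U r / r) t hx).2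
      (hint (t * x) (by positivity))
    refine IntegrableOn.congr_fun (h1.const_mul x) (fun r (hr : t < r) => ?_) measurableSet_Ioi
    have : 0 < r := ht0.trans hr
    field_simp
  have hT := hTpos t ht0
  rw [Real.dist_eq, hsub, div_sub' hT.ne', abs_div, abs_of_pos hT, div_lt_iff₀ hT, mul_comm,
    ← integral_const_mul, ← integral_sub hI ((hint t ht0).const_mul _)]
  calc _ ≤ ∫ r in Set.Ioi t, ε / 2 * (U r / r) := by
        rw [← Real.norm_eq_abs]
        refine norm_integral_le_of_norm_le ((hint t ht0).const_mul _) ?_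
        filter_upwards [ae_restrict_mem measurableSet_Ioi] with r (hr : t < r)
        have hr0 : 0 < r := ht0.trans hr
        have h := hN r (htN.trans hr.le)
        have hUr := hpos r hr0
        rw [Real.dist_eq, div_sub' hUr.ne', abs_div, abs_of_pos hUr, div_lt_iff₀ hUr] at h
        rw [Real.norm_eq_abs, show U (r * x) / r - x ^ (-α) * (U r / r)
          = (U (r * x) - U r * x ^ (-α)) / r by ring, abs_div, abs_of_pos hr0, ← mul_div_assoc]
        gcongr
    _ = ε / 2 * ∫ r in Set.Ioi t, U r / r := integral_const_mul _ _
    _ < ε * ∫ r in Set.Ioi t, U r / r := by nlinarith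

/-- Karamata's theorem. -/
theorem RegularlyVaryingAtTop.tendsto_div_tail (hU : ContinuousOn U (Set.Ioi 0))
    (hpos : ∀ r, 0 < r → 0 < U r) (hRV : RegularlyVaryingAtTop U (-α)) (hα : 0 < α)
    (hint : ∀ a, 0 < a → IntegrableOn (fun r => U r / r) (Set.Ioi a)) :
    Tendsto (fun t => U t / ∫ r in Set.Ioi t, U r / r) atTop (𝓝 α) := by
  have he : (1 : ℝ) < Real.exp 1 := by simp
  have he0 := Real.exp_pos 1
  set T : ℝ → ℝ := fun t => ∫ r in Set.Ioi t, U r / r with hT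
  -- The increment T(t) - T(et) is evaluated twice: it is asymptotic to U(t) (1 - e^(-α)) / α by
  -- uniform convergence on [t, et], and to T(t) (1 - e^(-α)) by regular variation of the tail. The
  -- quotient gives α.
  have hdiff : ∀ t, 0 < t → ∫ r in t..(Real.exp 1 * t), U r / r = T t - T (t * Real.exp 1) := by
    intro t ht
    rw [mul_comm t]
    exact (intervalIntegral.integral_Ioi_sub_Ioi (hint t ht) (by nlinarith)).symm
  have hc : 0 < (1 - Real.exp 1 ^ (-α)) := by
    have : Real.exp 1 ^ (-α) < 1 := Real.rpow_lt_one_of_one_lt_of_neg he (by linarith)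
    linarith
  have h1 : Tendsto (fun t => (T t - T (t * Real.exp 1)) / U t) atTop
      (𝓝 ((1 - Real.exp 1 ^ (-α)) / α)) := by
    rw [Metric.tendsto_nhds]
    intro ε hε
    filter_upwards [RegularlyVaryingAtTop.eventually_abs_sub_le hU hpos hRV hα
      (half_pos hε), eventually_gt_atTop 0] with t ht ht0
    have hUt := hpos t ht0
    have hle : t ≤ Real.exp 1 * t := by nlinarith
    have hmodel : ∫ r in t..(Real.exp 1 * t), U t * (r / t) ^ (-α) / r
        = U t * ((1 - Real.exp 1 ^ (-α)) / α) := by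
      have : ∀ r ∈ Set.uIcc t (Real.exp 1 * t), U t * (r / t) ^ (-α) / r
          = U t * t ^ α * r ^ (-α - 1) := by
        intro r hr
        rw [Set.uIcc_of_le hle] at hr
        have hr0 : 0 < r := ht0.trans_le hr.1
        rw [Real.div_rpow hr0.le ht0.le, Real.rpow_sub hr0, Real.rpow_one, Real.rpow_neg ht0.le]
        field_simp
      rw [intervalIntegral.integral_congr this, intervalIntegral.integral_const_mul,
        integral_rpow]
      · rw [show -α - 1 + 1 = -α by ring, Real.mul_rpow he0.le ht0.le, Real.rpow_neg ht0.le α]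
        have : 0 < t ^ α := Real.rpow_pos_of_pos ht0 _
        field_simp
        ring
      · right
        refine ⟨by linarith, ?_⟩
        rw [Set.uIcc_of_le hle]
        exact fun h => absurd h.1 (not_le.2 ht0)
    rw [Real.dist_eq, ← hdiff t ht0, div_sub' hUt.ne', abs_div, abs_of_pos hUt,
      div_lt_iff₀ hUt, ← hmodel, ← intervalIntegral.integral_sub]
    · have hb : ∀ r ∈ Set.uIoc t (Real.exp 1 * t),
          ‖U r / r - U t * (r / t) ^ (-α) / r‖ ≤ ε / 2 * U t / t := by
        intro r hr
        rw [Set.uIoc_of_le hle] at hr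
        have hr0 : 0 < r := ht0.trans hr.1
        rw [Real.norm_eq_abs, ← sub_div, abs_div, abs_of_pos hr0]
        have := ht r ⟨hr.1.le, hr.2⟩
        gcongr
        exact hr.1.le
      have := intervalIntegral.norm_integral_le_of_norm_le_const hb
      rw [Real.norm_eq_abs, show Real.exp 1 * t - t = (Real.exp 1 - 1) * t by ring, abs_mul,
        abs_of_pos ht0, abs_of_pos (sub_pos.2 he)] at this
      refine this.trans_lt ?_
      rw [show ε / 2 * U t / t * ((Real.exp 1 - 1) * t) = ε * U t * ((Real.exp 1 - 1) / 2) by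
        field_simp]
      -- The interval has length (e - 1) t and the integrand error is at most ε U(t) / (2t), so e <
      -- 3 suffices.
      have hlt : (Real.exp 1 - 1) / 2 < 1 := by linarith [Real.exp_one_lt_d9]
      nlinarith [mul_pos hε hUt]
    · exact ((hU.div continuousOn_id fun r hr => hr.ne').mono fun r hr => by
        rw [Set.uIcc_of_le hle] at hr; exact ht0.trans_le hr.1).intervalIntegrable
    · refine ContinuousOn.intervalIntegrable fun r hr => ?_
      rw [Set.uIcc_of_le hle] at hr
      have hr0 : 0 < r := ht0.trans_le hr.1
      have : 0 < r / t := by positivity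
      refine ContinuousAt.continuousWithinAt ?_
      exact ((continuousAt_const.mul ((continuousAt_id.div_const t).rpow_const
        (Or.inl this.ne'))).div continuousAt_id hr0.ne')
  -- For x = 1 the tail ratio is T(t) / T(t), which would be 0 by convention if T(t) = 0, whereas it
  -- tends to 1.
  have hTpos : ∀ᶠ t in atTop, T t ≠ 0 := by
    filter_upwards [(RegularlyVaryingAtTop.tendsto_tail_ratio hpos hRV hint one_pos).eventually_ne
      (by simp : (1 : ℝ) ^ (-α) ≠ 0)] with t ht h0
    simp only [T] at h0
    simp [h0] at ht
  have h2 : Tendsto (fun t => (T t - T (t * Real.exp 1)) / T t) atTop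
      (𝓝 (1 - Real.exp 1 ^ (-α))) := by
    refine ((RegularlyVaryingAtTop.tendsto_tail_ratio hpos hRV hint he0).const_sub 1).congr' ?_
    filter_upwards [hTpos] with t ht
    rw [sub_div, div_self ht]
  have h3 := h2.div h1 (by positivity)
  rw [div_div_cancel₀ hc.ne'] at h3
  refine h3.congr' ?_
  have h4 := h1.eventually_ne (by positivity : (1 - Real.exp 1 ^ (-α)) / α ≠ 0)
  filter_upwards [hTpos, h4, eventually_gt_atTop 0] with t ht h4 ht0
  have h5 := (div_ne_zero_iff.1 h4).1
  have h6 := (hpos t ht0).ne'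
  change _ = U t / T t
  simp only [Pi.div_apply]
  field_simp

end Karamata

/-! ### Polar coordinates and spherical means of the density. -/

/-- Integration in polar coordinates. -/
theorem integral_polar {d : ℕ} (hd : 1 ≤ d) {Φ : RSpace d → ℝ} (hΦ : Integrable Φ) :
    IntegrableOn (fun r : ℝ => r ^ (d - 1) * ∫ v : Theta d, Φ (r • (v : RSpace d)) ∂surfaceArea d)
      (Set.Ioi 0) ∧
    ∫ z, Φ z = ∫ r in Set.Ioi (0 : ℝ),
      r ^ (d - 1) * ∫ v : Theta d, Φ (r • (v : RSpace d)) ∂surfaceArea d := by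
  have : Nontrivial (RSpace d) := by
    rw [← Module.finrank_pos_iff (R := ℝ)]; simp; omega
  have hmp := (volume : Measure (RSpace d)).measurePreserving_homeomorphUnitSphereProd
  have hme := (homeomorphUnitSphereProd (RSpace d)).measurableEmbedding
  rw [finrank_euclideanSpace_fin] at hmp
  let Φ' : Theta d × Set.Ioi (0 : ℝ) → ℝ := fun p => Φ ((p.2 : ℝ) • (p.1 : RSpace d))
  have hΦ' : ∀ x : ({0}ᶜ : Set (RSpace d)), Φ' (homeomorphUnitSphereProd (RSpace d) x) = Φ x := by
    intro x
    have : (x : RSpace d) ≠ 0 := x.2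
    simp [Φ', this]
  have hi : Integrable Φ' ((surfaceArea d).prod (Measure.volumeIoiPow (d - 1))) := by
    rw [← hmp.integrable_comp_emb hme]
    have h1 : IntegrableOn Φ ({0}ᶜ : Set (RSpace d)) := hΦ.integrableOn
    rw [integrableOn_iff_comap_subtypeVal (measurableSet_singleton _).compl] at h1
    exact h1.congr (ae_of_all _ fun x => (hΦ' x).symm)
  have hnn : ∀ r : Set.Ioi (0 : ℝ), 0 ≤ (r : ℝ) ^ (d - 1) := fun r => pow_nonneg r.2.out.le _
  constructor
  · have h2 := hi.integral_prod_right
    rw [Measure.volumeIoiPow, integrable_withDensity_iff_integrable_smul' (by fun_prop)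
      (by simp)] at h2
    rw [integrableOn_iff_comap_subtypeVal measurableSet_Ioi]
    refine h2.congr (ae_of_all _ fun r => ?_)
    simp only [Function.comp, ENNReal.toReal_ofReal (hnn r), smul_eq_mul]
    rfl
  · calc ∫ z, Φ z = ∫ x : ({0}ᶜ : Set (RSpace d)), Φ x ∂(Measure.comap Subtype.val volume) := by
          rw [integral_subtype_comap (measurableSet_singleton _).compl Φ, restrict_compl_singleton]
      _ = ∫ p, Φ' p ∂((surfaceArea d).prod (Measure.volumeIoiPow (d - 1))) := by
          rw [← hmp.integral_comp hme]
          simp only [hΦ']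
      _ = ∫ r, (∫ v, Φ' (v, r) ∂surfaceArea d) ∂(Measure.volumeIoiPow (d - 1)) :=
          integral_prod_symm _ hi
      _ = _ := by
          simp only [Measure.volumeIoiPow, ENNReal.ofReal]
          rw [integral_withDensity_eq_integral_smul (by fun_prop),
            ← integral_subtype_comap measurableSet_Ioi (fun r : ℝ => r ^ (d - 1) *
              ∫ v : Theta d, Φ (r • (v : RSpace d)) ∂surfaceArea d)]
          refine integral_congr_ae (ae_of_all _ fun r => ?_)
          simp only [NNReal.smul_def, Real.coe_toNNReal _ (hnn r), smul_eq_mul]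
          rfl

/-- The integral of `f` over the sphere of radius `r`, with respect to the surface area of the unit
sphere. -/
noncomputable def sphereIntegral {d : ℕ} (f : RSpace d → ℝ) (r : ℝ) : ℝ :=
  ∫ v : Theta d, f (r • (v : RSpace d)) ∂surfaceArea d

section

variable {d : ℕ} {f : RSpace d → ℝ}

theorem continuous_sphereIntegral (hf : Continuous f) : Continuous (sphereIntegral f) := by
  unfold sphereIntegral
  have h := continuous_parametric_integral_of_continuous (μ := surfaceArea d)
    (f := fun (r : ℝ) (v : Theta d) => f (r • (v : RSpace d)))
    (by simp only [Function.uncurry_def]; fun_prop) isCompact_univ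
  simpa using h

theorem integrable_theta {g : Theta d → ℝ} (hg : Continuous g) : Integrable g (surfaceArea d) :=
  hg.integrable_of_hasCompactSupport (HasCompactSupport.of_compactSpace g)

theorem surfaceArea_ne_zero (hd : 1 ≤ d) : surfaceArea d ≠ 0 := by
  have : Nontrivial (RSpace d) := by
    rw [← Module.finrank_pos_iff (R := ℝ)]; simp; omega
  exact Measure.toSphere_ne_zero _

theorem integral_theta_pos (hd : 1 ≤ d) {g : Theta d → ℝ} (hg : Continuous g) (hpos : ∀ v, 0 < g v) :
    0 < ∫ v, g v ∂surfaceArea d := by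
  rw [integral_pos_iff_support_of_nonneg (fun v => (hpos v).le) (integrable_theta hg)]
  have : Function.support g = Set.univ := Set.eq_univ_of_forall fun v => (hpos v).ne'
  rw [this, Measure.measure_univ_pos]
  exact surfaceArea_ne_zero hd

theorem sphereIntegral_pos (hd : 1 ≤ d) (hf : Continuous f) (hpos : ∀ z, 0 < f z) (r : ℝ) :
    0 < sphereIntegral f r :=
  integral_theta_pos hd (by fun_prop) fun _ => hpos _

theorem integrable_of_isProbabilityMeasure (hf : Continuous f) (hpos : ∀ z, 0 < f z)
    [IsProbabilityMeasure ((volume : Measure (RSpace d)).withDensity fun z => ENNReal.ofReal (f z))] :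
    Integrable f := by
  refine ⟨hf.aestronglyMeasurable, ?_⟩
  rw [hasFiniteIntegral_iff_ofReal (ae_of_all _ fun z => (hpos z).le)]
  have h := measure_univ (μ := (volume : Measure (RSpace d)).withDensity
    fun z => ENNReal.ofReal (f z))
  rw [withDensity_apply _ MeasurableSet.univ, Measure.restrict_univ] at h
  simp [h]

/-- The expectation of a function of the direction on the event that the radius is large. -/
theorem setIntegral_direction (hd : 1 ≤ d) (hf : Continuous f) (hpos : ∀ z, 0 < f z)
    (hfi : Integrable f) {φ : RSpace d → ℝ} (hφ : Measurable φ) {C : ℝ}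
    (hφC : ∀ z, |φ z| ≤ C) {s : ℝ} (hs : 0 ≤ s) :
    IntegrableOn (fun r : ℝ => r ^ (d - 1) *
      ∫ v : Theta d, φ v * f (r • (v : RSpace d)) ∂surfaceArea d) (Set.Ioi s) ∧
    ∫ z in {z | s < ‖z‖}, φ (‖z‖⁻¹ • z)
        ∂(volume : Measure (RSpace d)).withDensity (fun z => ENNReal.ofReal (f z)) =
      ∫ r in Set.Ioi s, r ^ (d - 1) *
        ∫ v : Theta d, φ v * f (r • (v : RSpace d)) ∂surfaceArea d := by
  have hS : MeasurableSet {z : RSpace d | s < ‖z‖} :=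
    measurableSet_lt measurable_const measurable_norm
  -- At z = r v the indicator depends on r alone and the factor φ on v alone, so it cuts the radial
  -- integral down to r > s.
  let Φ : RSpace d → ℝ := {z : RSpace d | s < ‖z‖}.indicator fun z => φ (‖z‖⁻¹ • z) * f z
  have hΦ : Integrable Φ := by
    refine Integrable.indicator ?_ hS
    refine hfi.bdd_mul (c := C) ?_ (ae_of_all _ fun z => hφC _)
    exact (hφ.comp (by fun_prop)).aestronglyMeasurable
  have hpt : ∀ r : ℝ, 0 < r → ∀ v : Theta d, Φ (r • (v : RSpace d)) =
      (Set.Ioi s).indicator (fun r => φ v * f (r • (v : RSpace d))) r := by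
    intro r hr v
    have hv : ‖(v : RSpace d)‖ = 1 := by simp
    have hn : ‖r • (v : RSpace d)‖ = r := by rw [norm_smul, hv, mul_one, Real.norm_of_nonneg hr.le]
    simp only [Φ, Set.indicator_apply, Set.mem_ofPred_eq, Set.mem_Ioi, hn, smul_smul,
      inv_mul_cancel₀ hr.ne', one_smul]
  have hpt2 : ∀ r : ℝ, 0 < r → r ^ (d - 1) * ∫ v : Theta d, Φ (r • (v : RSpace d)) ∂surfaceArea d =
      (Set.Ioi s).indicator (fun r => r ^ (d - 1) *
        ∫ v : Theta d, φ v * f (r • (v : RSpace d)) ∂surfaceArea d) r := by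
    intro r hr
    simp only [hpt r hr]
    by_cases h : r ∈ Set.Ioi s <;> simp [h]
  obtain ⟨h1, h2⟩ := integral_polar hd hΦ
  have hsub : Set.Ioi s ⊆ Set.Ioi (0 : ℝ) := Set.Ioi_subset_Ioi hs
  constructor
  · have h3 := IntegrableOn.congr_fun h1 (fun r hr => hpt2 r hr) measurableSet_Ioi
    refine IntegrableOn.congr_fun (h3.mono_set hsub) (fun r hr => ?_) measurableSet_Ioi
    simp only [Set.indicator_of_mem hr]
  · have hc : ∀ z, ((f z).toNNReal : ℝ) = f z := fun z => Real.coe_toNNReal _ (hpos z).le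
    rw [restrict_withDensity hS]
    simp only [ENNReal.ofReal]
    rw [integral_withDensity_eq_integral_smul (by fun_prop),
      show (∫ z in {z : RSpace d | s < ‖z‖}, (f z).toNNReal • φ (‖z‖⁻¹ • z)) = ∫ z, Φ z by
        rw [← integral_indicator hS]
        congr 1
        ext z
        simp only [Φ, NNReal.smul_def, hc, smul_eq_mul, mul_comm],
      h2, setIntegral_congr_fun measurableSet_Ioi fun r hr => hpt2 r hr,
      setIntegral_indicator measurableSet_Ioi, Set.inter_eq_self_of_subset_right hsub]

end

/-! ### The regularly varying density and its spectral density. -/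

/-- The measure with density `f`. -/
noncomputable abbrev densityMeasure {d : ℕ} (f : RSpace d → ℝ) : Measure (RSpace d) :=
  volume.withDensity fun z => ENNReal.ofReal (f z)

/-- The limit `q` of the density, normalised so as to have integral `1` over the unit sphere. -/
noncomputable def normalizedLimit {d : ℕ} (q : RSpace d → ℝ) (v : Theta d) : ℝ :=
  q v / ∫ v : Theta d, q v ∂surfaceArea d

section

variable {d : ℕ} {f q : RSpace d → ℝ} {α : ℝ} {V : ℝ → ℝ}

namespace DensityRegularVariation

theorem continuous_limit (hf : DensityRegularVariation f α q V) :
    Continuous fun v : Theta d => q v := by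
  have h : ContinuousOn q (Metric.sphere (0 : RSpace d) 1) := by
    refine hf.tendsto_uniformly.continuousOn (Eventually.frequently (Eventually.of_forall ?_))
    intro t
    have := hf.continuous_density
    fun_prop
  exact continuousOn_iff_continuous_domRestrict.1 h

theorem limit_pos (hf : DensityRegularVariation f α q V) (v : Theta d) : 0 < q v :=
  hf.q_pos _ (ne_zero_of_mem_unit_sphere v)

theorem integral_limit_pos (hd : 1 ≤ d) (hf : DensityRegularVariation f α q V) :
    0 < ∫ v : Theta d, q v ∂surfaceArea d :=
  integral_theta_pos hd hf.continuous_limit hf.limit_pos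

theorem continuous_normalizedLimit (hf : DensityRegularVariation f α q V) :
    Continuous (normalizedLimit (d := d) q) :=
  hf.continuous_limit.div_const _

theorem normalizedLimit_pos (hd : 1 ≤ d) (hf : DensityRegularVariation f α q V) (v : Theta d) :
    0 < normalizedLimit q v :=
  div_pos (hf.limit_pos v) (hf.integral_limit_pos hd)

theorem integral_normalizedLimit (hd : 1 ≤ d) (hf : DensityRegularVariation f α q V) :
    ∫ v, normalizedLimit q v ∂surfaceArea d = 1 := by
  unfold normalizedLimit
  rw [integral_div, div_self (hf.integral_limit_pos hd).ne']

theorem eventually_abs_sub_le (hf : DensityRegularVariation f α q V) {ε : ℝ} (hε : 0 < ε) :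
    ∀ᶠ t : ℝ in atTop, ∀ v : Theta d,
      |f (t • (v : RSpace d)) - q v * (t ^ (-(d : ℝ)) * V t)| ≤ ε * (t ^ (-(d : ℝ)) * V t) := by
  filter_upwards [Metric.tendstoUniformlyOn_iff.1 hf.tendsto_uniformly ε hε,
    eventually_gt_atTop 0] with t ht ht0 v
  have ha : 0 < t ^ (-(d : ℝ)) * V t := mul_pos (Real.rpow_pos_of_pos ht0 _) (hf.V_pos t ht0)
  have h := ht v v.2
  rw [dist_comm, Real.dist_eq, div_sub' ha.ne', abs_div, abs_of_pos ha, div_lt_iff₀ ha] at h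
  rw [mul_comm (q v)]
  exact h.le

theorem eventually_abs_sphereIntegral_sub_le (hf : DensityRegularVariation f α q V)
    {ε : ℝ} (hε : 0 < ε) :
    ∀ᶠ t : ℝ in atTop,
      |sphereIntegral f t - (∫ v : Theta d, q v ∂surfaceArea d) * (t ^ (-(d : ℝ)) * V t)| ≤
        ε * (surfaceArea d).real Set.univ * (t ^ (-(d : ℝ)) * V t) := by
  filter_upwards [hf.eventually_abs_sub_le hε] with t ht
  have hc : Continuous fun v : Theta d => f (t • (v : RSpace d)) := by
    have := hf.continuous_density
    fun_prop
  unfold sphereIntegral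
  rw [← integral_mul_const, ← integral_sub (integrable_theta hc)
    ((integrable_theta hf.continuous_limit).mul_const _), ← Real.norm_eq_abs]
  refine (norm_integral_le_of_norm_le_const (ae_of_all _ ht)).trans (le_of_eq ?_)
  ring

theorem tendsto_sphereIntegral (hf : DensityRegularVariation f α q V) :
    Tendsto (fun t : ℝ => sphereIntegral f t / (t ^ (-(d : ℝ)) * V t)) atTop
      (𝓝 (∫ v : Theta d, q v ∂surfaceArea d)) := by
  rw [Metric.tendsto_nhds]
  intro ε hε
  set L := (surfaceArea d).real Set.univ
  have hL : 0 ≤ L := measureReal_nonneg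
  filter_upwards [hf.eventually_abs_sphereIntegral_sub_le (ε := ε / (2 * (L + 1))) (by positivity),
    eventually_gt_atTop 0] with t ht ht0
  have ha : 0 < t ^ (-(d : ℝ)) * V t := mul_pos (Real.rpow_pos_of_pos ht0 _) (hf.V_pos t ht0)
  rw [Real.dist_eq, div_sub' ha.ne', abs_div, abs_of_pos ha, div_lt_iff₀ ha, mul_comm (_ * _)]
  refine ht.trans_lt (mul_lt_mul_of_pos_right ?_ ha)
  rw [div_mul_eq_mul_div, div_lt_iff₀ (by positivity)]
  nlinarith

/-- The density on a sphere of large radius is close to its mean over that sphere times the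
normalised limit. -/
theorem eventually_abs_sub_normalizedLimit_le (hd : 1 ≤ d) (hf : DensityRegularVariation f α q V)
    {ε : ℝ} (hε : 0 < ε) :
    ∀ᶠ t : ℝ in atTop, ∀ v : Theta d,
      |f (t • (v : RSpace d)) - normalizedLimit q v * sphereIntegral f t| ≤
        ε * sphereIntegral f t := by
  set Q := ∫ v : Theta d, q v ∂surfaceArea d with hQ
  have hQ0 : 0 < Q := hf.integral_limit_pos hd
  obtain ⟨B, hB⟩ := isCompact_univ.exists_bound_of_continuousOn
    hf.continuous_normalizedLimit.continuousOn
  have hB' : ∀ v, normalizedLimit q v ≤ |B| := fun v =>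
    (le_abs_self _).trans ((hB v trivial).trans (le_abs_self _))
  have hp := fun v => (hf.normalizedLimit_pos hd v).le
  -- The total error is η (1 + |B|) a = ε Q a / 2, and Q a ≤ 2 g absorbs the constant.
  set η := ε * Q / (2 * (1 + |B|)) with hη
  have hη0 : 0 < η := by positivity
  have hg : ∀ᶠ t : ℝ in atTop, 0 < t ∧
      |sphereIntegral f t / (t ^ (-(d : ℝ)) * V t) - Q| ≤ min η (Q / 2) := by
    filter_upwards [(Metric.tendsto_nhds.1 hf.tendsto_sphereIntegral) (min η (Q / 2))
      (by positivity), eventually_gt_atTop 0] with t ht ht0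
    rw [Real.dist_eq] at ht
    exact ⟨ht0, ht.le⟩
  filter_upwards [hf.eventually_abs_sub_le hη0, hg] with t ht htg v
  obtain ⟨ht0, hg⟩ := htg
  set a := t ^ (-(d : ℝ)) * V t
  have ha : 0 < a := mul_pos (Real.rpow_pos_of_pos ht0 _) (hf.V_pos t ht0)
  set g := sphereIntegral f t
  rw [div_sub' ha.ne', abs_div, abs_of_pos ha, div_le_iff₀ ha, mul_comm a] at hg
  have hg1 : |g - Q * a| ≤ η * a := hg.trans (by gcongr; exact min_le_left _ _)
  have hg2 : |g - Q * a| ≤ Q / 2 * a := hg.trans (by gcongr; exact min_le_right _ _)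
  have hga : Q * a ≤ 2 * g := by linarith [(abs_le.1 hg2).1]
  have hqv : q v = normalizedLimit q v * Q := by
    unfold normalizedLimit; rw [← hQ]; field_simp
  have heq : f (t • (v : RSpace d)) - normalizedLimit q v * g
      = (f (t • (v : RSpace d)) - q v * a) - normalizedLimit q v * (g - Q * a) := by
    rw [hqv]; ring
  rw [heq]
  calc _ ≤ |f (t • (v : RSpace d)) - q v * a| + |normalizedLimit q v * (g - Q * a)| := abs_sub _ _
    _ ≤ η * a + |B| * (η * a) := by
        rw [abs_mul, abs_of_nonneg (hp v)]
        exact add_le_add (ht v) (mul_le_mul (hB' v) hg1 (abs_nonneg _) (abs_nonneg _))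
    _ = ε * (Q * a) / 2 := by rw [hη]; field_simp
    _ ≤ ε * g := by nlinarith

/-- The function is asymptotic to a constant times V and inherits its index. It is continuous, as
the Karamata lemmas need, and divided by r it is the density of the radius. -/
theorem regularlyVarying_sphereIntegral (hd : 1 ≤ d) (hf : DensityRegularVariation f α q V) :
    RegularlyVaryingAtTop (fun r : ℝ => r ^ d * sphereIntegral f r) (-α) := by
  intro x hx
  have hQ := (hf.integral_limit_pos hd).ne'
  have hlim : Tendsto (fun t : ℝ => t ^ d * sphereIntegral f t / V t) atTop
      (𝓝 (∫ v : Theta d, q v ∂surfaceArea d)) := by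
    refine hf.tendsto_sphereIntegral.congr' ?_
    filter_upwards [eventually_gt_atTop 0] with t ht
    rw [Real.rpow_neg ht.le, Real.rpow_natCast]
    have := (hf.V_pos t ht).ne'
    field_simp
  have h1 := hlim.comp (tendsto_id.atTop_mul_const hx)
  have h2 := (h1.mul (hf.V_regularlyVarying x hx)).div hlim hQ
  rw [mul_div_cancel_left₀ _ hQ] at h2
  refine h2.congr' ?_
  filter_upwards [eventually_gt_atTop 0] with t ht
  have h3 := (hf.V_pos t ht).ne'
  have h4 := (hf.V_pos (t * x) (by positivity)).ne'
  have h5 := (sphereIntegral_pos hd hf.continuous_density hf.density_pos t).ne'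
  simp only [Function.comp, Pi.div_apply, id]
  field_simp

theorem pow_mul_sphereIntegral_div (hd : 1 ≤ d) {r : ℝ} (hr : 0 < r) :
    r ^ d * sphereIntegral f r / r = r ^ (d - 1) * sphereIntegral f r := by
  obtain ⟨d, rfl⟩ : ∃ m, d = m + 1 := ⟨d - 1, by omega⟩
  rw [Nat.add_sub_cancel, pow_succ]
  field_simp

/-- Spheres are null sets, which reconciles the closed events ‖X‖ ≥ t of the spectral measure with
the strict exceedances used elsewhere. -/
theorem measure_norm_eq (hd : 1 ≤ d) (s : ℝ) :
    densityMeasure f {z : RSpace d | ‖z‖ = s} = 0 := by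
  have : Nontrivial (RSpace d) := by
    rw [← Module.finrank_pos_iff (R := ℝ)]; simp; omega
  refine withDensity_absolutelyContinuous _ _ ?_
  have := Measure.addHaar_sphere (volume : Measure (RSpace d)) 0 s
  simpa [Metric.sphere] using this

variable [IsProbabilityMeasure (densityMeasure f)]

theorem integrable_density (hf : DensityRegularVariation f α q V) : Integrable f :=
  integrable_of_isProbabilityMeasure hf.continuous_density hf.density_pos

theorem integrableOn_sphereIntegral (hd : 1 ≤ d) (hf : DensityRegularVariation f α q V) {s : ℝ}
    (hs : 0 ≤ s) :
    IntegrableOn (fun r : ℝ => r ^ (d - 1) * sphereIntegral f r) (Set.Ioi s) := by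
  have := (setIntegral_direction hd hf.continuous_density hf.density_pos hf.integrable_density
    (φ := fun _ => 1) measurable_const (C := 1) (by simp) hs).1
  simpa [sphereIntegral] using this

theorem measureReal_norm_gt (hd : 1 ≤ d) (hf : DensityRegularVariation f α q V) {s : ℝ}
    (hs : 0 ≤ s) :
    (densityMeasure f).real {z | s < ‖z‖} =
      ∫ r in Set.Ioi s, r ^ (d - 1) * sphereIntegral f r := by
  have := (setIntegral_direction hd hf.continuous_density hf.density_pos hf.integrable_density
    (φ := fun _ => 1) measurable_const (C := 1) (by simp) hs).2
  simpa [sphereIntegral] using this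

theorem measureReal_norm_gt_pos (hd : 1 ≤ d) (hf : DensityRegularVariation f α q V) {s : ℝ}
    (hs : 0 ≤ s) : 0 < (densityMeasure f).real {z | s < ‖z‖} := by
  rw [hf.measureReal_norm_gt hd hs, setIntegral_pos_iff_support_of_nonneg_ae _
    (hf.integrableOn_sphereIntegral hd hs)]
  · have : Set.Ioi s ⊆ Function.support fun r => r ^ (d - 1) * sphereIntegral f r := fun r hr => by
      have hr0 : 0 < r := hs.trans_lt hr
      exact (mul_pos (pow_pos hr0 _)
        (sphereIntegral_pos hd hf.continuous_density hf.density_pos r)).ne'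
    rw [Set.inter_eq_self_of_subset_right this]
    simp
  · filter_upwards [ae_restrict_mem measurableSet_Ioi] with r (hr : s < r)
    have hr0 : 0 < r := hs.trans_lt hr
    exact (mul_pos (pow_pos hr0 _)
      (sphereIntegral_pos hd hf.continuous_density hf.density_pos r)).le

/-- The joint law of a large radius and the direction: the direction has nearly the density
`normalizedLimit q`. -/
theorem eventually_abs_setIntegral_direction_sub_le (hd : 1 ≤ d)
    (hf : DensityRegularVariation f α q V) {ε : ℝ} (hε : 0 < ε) :
    ∀ᶠ s : ℝ in atTop, ∀ φ : RSpace d → ℝ, Measurable φ → (∀ z, 0 ≤ φ z) → (∀ z, φ z ≤ 1) →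
      |∫ z in {z | s < ‖z‖}, φ (‖z‖⁻¹ • z) ∂densityMeasure f -
        (densityMeasure f).real {z | s < ‖z‖} *
          ∫ v : Theta d, φ v * normalizedLimit q v ∂surfaceArea d| ≤
      ε * (densityMeasure f).real {z | s < ‖z‖} * ∫ v : Theta d, φ v ∂surfaceArea d := by
  -- The approximation of f on spheres is integrated against the weight φ. The error is thus
  -- proportional to ∫ φ and uniform in φ, which keeps it relative even when φ lives on a shrinking
  -- cap.
  obtain ⟨N, hN⟩ := eventually_atTop.1 (hf.eventually_abs_sub_normalizedLimit_le hd hε)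
  filter_upwards [eventually_ge_atTop N, eventually_ge_atTop 0] with s hsN hs0 φ hφ hφ0 hφ1
  have hφa : ∀ z, |φ z| ≤ 1 := fun z => by rw [abs_of_nonneg (hφ0 z)]; exact hφ1 z
  obtain ⟨h1, h2⟩ := setIntegral_direction hd hf.continuous_density hf.density_pos
    hf.integrable_density hφ hφa hs0
  have hφm : AEStronglyMeasurable (fun v : Theta d => φ v) (surfaceArea d) :=
    (hφ.comp measurable_subtype_coe).aestronglyMeasurable
  have hmul : ∀ g : Theta d → ℝ, Continuous g →
      Integrable (fun v : Theta d => φ v * g v) (surfaceArea d) := fun g hg =>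
    (integrable_theta hg).bdd_mul (c := 1) hφm (ae_of_all _ fun v => hφa _)
  have hφi : Integrable (fun v : Theta d => φ v) (surfaceArea d) := by
    simpa using hmul (fun _ => 1) continuous_const
  have hgi := hf.integrableOn_sphereIntegral hd hs0
  rw [h2, hf.measureReal_norm_gt hd hs0, ← integral_mul_const, mul_assoc, ← integral_mul_const,
    ← integral_const_mul, ← integral_sub h1 (hgi.mul_const _), ← Real.norm_eq_abs]
  refine norm_integral_le_of_norm_le ((hgi.mul_const _).const_mul _) ?_
  filter_upwards [ae_restrict_mem measurableSet_Ioi] with r (hr : s < r)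
  have hr0 : 0 < r := hs0.trans_lt hr
  have hc : Continuous fun v : Theta d => f (r • (v : RSpace d)) := by
    have := hf.continuous_density
    fun_prop
  rw [mul_assoc, ← mul_sub, norm_mul, Real.norm_of_nonneg (pow_nonneg hr0.le _),
    show ε * (r ^ (d - 1) * sphereIntegral f r * ∫ v : Theta d, φ v ∂surfaceArea d) =
      r ^ (d - 1) * (ε * sphereIntegral f r * ∫ v : Theta d, φ v ∂surfaceArea d) by ring]
  refine mul_le_mul_of_nonneg_left ?_ (pow_nonneg hr0.le _)
  rw [← integral_const_mul, ← integral_const_mul,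
    ← integral_sub (hmul _ hc) ((hmul _ hf.continuous_normalizedLimit).const_mul _)]
  refine norm_integral_le_of_norm_le (hφi.const_mul _) (ae_of_all _ fun v => ?_)
  rw [show φ v * f (r • (v : RSpace d)) - sphereIntegral f r * (φ v * normalizedLimit q v) =
    φ v * (f (r • (v : RSpace d)) - normalizedLimit q v * sphereIntegral f r) by ring, norm_mul,
    Real.norm_of_nonneg (hφ0 _), mul_comm]
  exact mul_le_mul_of_nonneg_right (hN r (hsN.trans hr.le) v) (hφ0 _)

theorem measureReal_norm_gt' (hd : 1 ≤ d) (hf : DensityRegularVariation f α q V) {s : ℝ}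
    (hs : 0 ≤ s) :
    (densityMeasure f).real {z | s < ‖z‖} =
      ∫ r in Set.Ioi s, r ^ d * sphereIntegral f r / r := by
  rw [hf.measureReal_norm_gt hd hs]
  exact setIntegral_congr_fun measurableSet_Ioi fun r hr =>
    (pow_mul_sphereIntegral_div hd (hs.trans_lt hr)).symm

theorem integrableOn_pow_mul_sphereIntegral_div (hd : 1 ≤ d)
    (hf : DensityRegularVariation f α q V) (a : ℝ) (ha : 0 < a) :
    IntegrableOn (fun r => r ^ d * sphereIntegral f r / r) (Set.Ioi a) :=
  IntegrableOn.congr_fun (hf.integrableOn_sphereIntegral hd ha.le)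
    (fun _ hr => (pow_mul_sphereIntegral_div hd (ha.trans hr)).symm) measurableSet_Ioi

theorem tendsto_tail_ratio (hd : 1 ≤ d) (hf : DensityRegularVariation f α q V) {x : ℝ}
    (hx : 0 < x) :
    Tendsto (fun t => (densityMeasure f).real {z | t * x < ‖z‖} /
      (densityMeasure f).real {z | t < ‖z‖}) atTop (𝓝 (x ^ (-α))) := by
  refine (RegularlyVaryingAtTop.tendsto_tail_ratio (U := fun r => r ^ d * sphereIntegral f r)
    (fun r hr => mul_pos (pow_pos hr _)
      (sphereIntegral_pos hd hf.continuous_density hf.density_pos r))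
    (hf.regularlyVarying_sphereIntegral hd)
    (hf.integrableOn_pow_mul_sphereIntegral_div hd) hx).congr' ?_
  filter_upwards [eventually_ge_atTop 0] with t ht
  rw [hf.measureReal_norm_gt' hd ht, hf.measureReal_norm_gt' hd (by positivity)]

theorem tendsto_pow_mul_sphereIntegral_div_tail (hd : 1 ≤ d) (hα : 0 < α)
    (hf : DensityRegularVariation f α q V) :
    Tendsto (fun t : ℝ => t ^ d * sphereIntegral f t / (densityMeasure f).real {z | t < ‖z‖}) atTop
      (𝓝 α) := by
  refine (RegularlyVaryingAtTop.tendsto_div_tail (U := fun r => r ^ d * sphereIntegral f r)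
    ?_ (fun r hr => mul_pos (pow_pos hr _)
      (sphereIntegral_pos hd hf.continuous_density hf.density_pos r))
    (hf.regularlyVarying_sphereIntegral hd) hα
    (hf.integrableOn_pow_mul_sphereIntegral_div hd)).congr' ?_
  · have := continuous_sphereIntegral hf.continuous_density
    fun_prop
  · filter_upwards [eventually_ge_atTop 0] with t ht
    rw [hf.measureReal_norm_gt' hd ht]

/-- With φ the indicator of A, the ratio is the tail ratio G(tx) / G(t) times the conditional
probability of A given ‖X‖ > tx. -/
theorem isSpectralMeasure (hd : 1 ≤ d) (hf : DensityRegularVariation f α q V) :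
    IsSpectralMeasure (densityMeasure f) α
      ((surfaceArea d).withDensity fun w => ENNReal.ofReal (normalizedLimit q w)) := by
  have hψi := integrable_theta hf.continuous_normalizedLimit
  have hψ0 : 0 ≤ᵐ[surfaceArea d] normalizedLimit q :=
    ae_of_all _ fun v => (hf.normalizedLimit_pos hd v).le
  refine ⟨⟨?_⟩, fun x hx A hA _ => ?_⟩
  · rw [withDensity_apply _ MeasurableSet.univ, Measure.restrict_univ,
      ← ofReal_integral_eq_lintegral_ofReal hψi hψ0, hf.integral_normalizedLimit hd]
    simp
  have hAm : MeasurableSet (Subtype.val '' A : Set (RSpace d)) :=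
    Metric.isClosed_sphere.measurableSet.subtype_image hA
  let φ : RSpace d → ℝ := (Subtype.val '' A : Set (RSpace d)).indicator fun _ => 1
  have hφ : Measurable φ := measurable_const.indicator hAm
  have hφ0 : ∀ z, 0 ≤ φ z := fun z => Set.indicator_nonneg (fun _ _ => zero_le_one) z
  have hφ1 : ∀ z, φ z ≤ 1 := fun z => Set.indicator_le' (fun _ _ => le_rfl) (fun _ _ => zero_le_one) z
  have hφv : ∀ v : Theta d, φ v = A.indicator (fun _ => 1) v := fun v => by
    by_cases h : v ∈ A <;> simp [φ, h]
  have hΨ : ((surfaceArea d).withDensity fun w => ENNReal.ofReal (normalizedLimit q w)).real A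
      = ∫ v : Theta d, φ v * normalizedLimit q v ∂surfaceArea d := by
    rw [measureReal_def, withDensity_apply _ hA,
      ← ofReal_integral_eq_lintegral_ofReal hψi.integrableOn (ae_restrict_of_ae hψ0),
      ENNReal.toReal_ofReal (integral_nonneg fun v => (hf.normalizedLimit_pos hd v).le),
      ← integral_indicator hA]
    congr 1
    ext v
    rw [hφv]
    by_cases h : v ∈ A <;> simp [h]
  have hset : ∀ s : ℝ, (densityMeasure f).real {z | s ≤ ‖z‖ ∧ ‖z‖⁻¹ • z ∈ Subtype.val '' A} =
      ∫ z in {z | s < ‖z‖}, φ (‖z‖⁻¹ • z) ∂densityMeasure f := by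
    intro s
    have hm : MeasurableSet {z : RSpace d | ‖z‖⁻¹ • z ∈ (Subtype.val '' A : Set (RSpace d))} :=
      hAm.preimage (by fun_prop)
    have h1 : (∫ z in {z | s < ‖z‖}, φ (‖z‖⁻¹ • z) ∂densityMeasure f) =
        ∫ z in {z | s < ‖z‖}, {z : RSpace d | ‖z‖⁻¹ • z ∈
          (Subtype.val '' A : Set (RSpace d))}.indicator (fun _ => (1 : ℝ)) z
          ∂densityMeasure f := rfl
    rw [h1, integral_indicator_const _ hm, smul_eq_mul, mul_one,
      measureReal_restrict_apply hm]
    refine measureReal_congr ?_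
    have h0 : ∀ᵐ z ∂densityMeasure f, ‖z‖ ≠ s := by
      rw [ae_iff]; simpa using measure_norm_eq (f := f) hd s
    filter_upwards [h0] with z hz
    refine propext ?_
    change (s ≤ ‖z‖ ∧ _) ↔ (_ ∧ s < ‖z‖)
    rw [and_comm, le_iff_lt_or_eq, or_iff_left (fun h => hz h.symm)]
    rfl
  have hset2 : ∀ s : ℝ, (densityMeasure f).real {z | s ≤ ‖z‖} =
      (densityMeasure f).real {z | s < ‖z‖} := by
    intro s
    refine measureReal_congr ?_
    have h0 : ∀ᵐ z ∂densityMeasure f, ‖z‖ ≠ s := by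
      rw [ae_iff]; simpa using measure_norm_eq (f := f) hd s
    filter_upwards [h0] with z hz
    refine propext ?_
    change s ≤ ‖z‖ ↔ s < ‖z‖
    rw [le_iff_lt_or_eq, or_iff_left (fun h => hz h.symm)]
  simp only [hset, hset2, hΨ]
  have hlim : Tendsto (fun s : ℝ => (∫ z in {z | s < ‖z‖}, φ (‖z‖⁻¹ • z) ∂densityMeasure f) /
      (densityMeasure f).real {z | s < ‖z‖}) atTop
      (𝓝 (∫ v : Theta d, φ v * normalizedLimit q v ∂surfaceArea d)) := by
    rw [Metric.tendsto_nhds]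
    intro ε hε
    set I := ∫ v : Theta d, φ v ∂surfaceArea d
    have hI : 0 ≤ I := integral_nonneg fun v => hφ0 _
    filter_upwards [hf.eventually_abs_setIntegral_direction_sub_le hd (ε := ε / (2 * (I + 1)))
      (by positivity), eventually_ge_atTop 0] with s hs hs0
    have hG := hf.measureReal_norm_gt_pos hd hs0
    rw [Real.dist_eq, div_sub' hG.ne', abs_div, abs_of_pos hG, div_lt_iff₀ hG]
    refine (hs φ hφ hφ0 hφ1).trans_lt ?_
    rw [mul_right_comm]
    refine mul_lt_mul_of_pos_right ?_ hG
    rw [div_mul_eq_mul_div, div_lt_iff₀ (by positivity)]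
    nlinarith
  have h3 := (hf.tendsto_tail_ratio hd hx).mul (hlim.comp (tendsto_id.atTop_mul_const hx))
  refine h3.congr' ?_
  filter_upwards [eventually_ge_atTop 0] with t ht
  have hG := (hf.measureReal_norm_gt_pos hd ht).ne'
  have hG2 := (hf.measureReal_norm_gt_pos hd (s := t * x) (by positivity)).ne'
  simp only [Function.comp, id]
  field_simp

/-- At radius t r, with g and G as above, the quotient factors as f / g → ψ(w), (tr)^d g(tr) / G(tr)
→ α by Karamata, G(tr) / G(t) → r^(-α), and r^(-d). -/
theorem isSpectralDensity (hd : 1 ≤ d) (hα : 0 < α) (hf : DensityRegularVariation f α q V) :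
    IsSpectralDensity (densityMeasure f) f α (normalizedLimit q) where
  continuous := hf.continuous_normalizedLimit
  nonneg v := (hf.normalizedLimit_pos hd v).le
  isSpectralMeasure := hf.isSpectralMeasure hd
  tendsto_density r w hr := by
    have h1 : Tendsto (fun t : ℝ => f (t • (w : RSpace d)) / sphereIntegral f t) atTop
        (𝓝 (normalizedLimit q w)) := by
      rw [Metric.tendsto_nhds]
      intro ε hε
      filter_upwards [hf.eventually_abs_sub_normalizedLimit_le hd (half_pos hε)] with t ht
      have hg := sphereIntegral_pos hd hf.continuous_density hf.density_pos t
      rw [Real.dist_eq, div_sub' hg.ne', abs_div, abs_of_pos hg, div_lt_iff₀ hg, mul_comm (sphereIntegral f t)]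
      exact (ht w).trans_lt (by nlinarith)
    have htr : Tendsto (fun t : ℝ => t * r) atTop atTop := tendsto_id.atTop_mul_const hr
    have h2 := (h1.comp htr).mul (((hf.tendsto_pow_mul_sphereIntegral_div_tail hd hα).comp htr).mul
      ((hf.tendsto_tail_ratio hd hr).mul_const (r ^ (-(d : ℝ)))))
    rw [show normalizedLimit q w * (α * (r ^ (-α) * r ^ (-(d : ℝ)))) =
      α * r ^ (-α - d) * normalizedLimit q w by
        rw [← Real.rpow_add hr, ← sub_eq_add_neg]; ring] at h2
    refine h2.congr' ?_
    filter_upwards [eventually_gt_atTop 0] with t ht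
    have hG := (hf.measureReal_norm_gt_pos hd ht.le).ne'
    have hG2 := (hf.measureReal_norm_gt_pos hd (s := t * r) (by positivity)).ne'
    have hg := (sphereIntegral_pos hd hf.continuous_density hf.density_pos (t * r)).ne'
    simp only [Function.comp, smul_smul]
    rw [Real.rpow_neg ht.le, Real.rpow_natCast, Real.rpow_neg hr.le, Real.rpow_natCast, mul_pow]
    field_simp

end DensityRegularVariation

/-- The spectral density is unique. -/
theorem IsSpectralDensity.eq {μ : Measure (RSpace d)} (hα : α ≠ 0) {ψ ψ' : Theta d → ℝ}
    (h : IsSpectralDensity μ f α ψ) (h' : IsSpectralDensity μ f α ψ') : ψ = ψ' := by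
  ext w
  have := tendsto_nhds_unique (h.tendsto_density 1 w one_pos) (h'.tendsto_density 1 w one_pos)
  simpa [hα] using this

end

/-! ### Chernoff bounds for [0, 1]-valued variables. -/

section Chernoff

variable {Ω : Type*} [MeasurableSpace Ω] {P : Measure Ω} [IsProbabilityMeasure P]

/-- From exp(u) ≤ 1 + u + u² for |u| ≤ 1 and Y² ≤ Y, the second-order term is controlled by the
mean. This matters because exceedances are rare. -/
theorem mgf_le_of_mem_Icc {Y : Ω → ℝ} (hY : Measurable Y) (h0 : ∀ ω, 0 ≤ Y ω) (h1 : ∀ ω, Y ω ≤ 1)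
    {t : ℝ} (ht : |t| ≤ 1) : mgf Y P t ≤ Real.exp (P[Y] * (t + t ^ 2)) := by
  have hi : Integrable Y P := Integrable.of_bound hY.aestronglyMeasurable 1
    (ae_of_all _ fun ω => by rw [Real.norm_of_nonneg (h0 ω)]; exact h1 ω)
  have hb : ∀ ω, Real.exp (t * Y ω) ≤ 1 + Y ω * (t + t ^ 2) := by
    intro ω
    have h2 : |t * Y ω| ≤ 1 := by
      rw [abs_mul, abs_of_nonneg (h0 ω)]
      exact mul_le_one₀ ht (h0 ω) (h1 ω)
    have h3 := (abs_le.1 (Real.abs_exp_sub_one_sub_id_le h2)).2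
    have h4 : Y ω ^ 2 ≤ Y ω := by nlinarith [h0 ω, h1 ω]
    nlinarith [sq_nonneg t, mul_le_mul_of_nonneg_left h4 (sq_nonneg t)]
  have hr : Integrable (fun ω => 1 + Y ω * (t + t ^ 2)) P := (integrable_const _).add (hi.mul_const _)
  calc mgf Y P t ≤ ∫ ω, (1 + Y ω * (t + t ^ 2)) ∂P := by
        refine integral_mono_of_nonneg (ae_of_all _ fun ω => (Real.exp_pos _).le) hr
          (ae_of_all _ hb)
    _ = P[Y] * (t + t ^ 2) + 1 := by
        rw [integral_add (integrable_const _) (hi.mul_const _), integral_mul_const]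
        simp [add_comm]
    _ ≤ _ := Real.add_one_le_exp _

/-- A Chernoff bound for sums of independent random variables with values in `[0, 1]`. -/
theorem measureReal_abs_sum_sub_ge_le {Y : ℕ → Ω → ℝ} (hY : ∀ i, Measurable (Y i))
    (h0 : ∀ i ω, 0 ≤ Y i ω) (h1 : ∀ i ω, Y i ω ≤ 1) (hind : iIndepFun Y P) {p : ℝ}
    (hp : ∀ i, P[Y i] = p) (n : ℕ) (a : ℝ) {t : ℝ} (ht0 : 0 ≤ t) (ht1 : t ≤ 1) :
    P.real {ω | a ≤ |∑ i ∈ Finset.range n, Y i ω - n * p|} ≤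
      2 * Real.exp (-(t * a) + n * p * t ^ 2) := by
  set S : Ω → ℝ := ∑ i ∈ Finset.range n, Y i with hS
  have hSω : ∀ ω, S ω = ∑ i ∈ Finset.range n, Y i ω := fun ω => by simp [hS]
  have hSm : Measurable S := by
    rw [show S = fun ω => ∑ i ∈ Finset.range n, Y i ω from funext hSω]
    fun_prop
  have hS0 : ∀ ω, |S ω| ≤ n := by
    intro ω
    rw [hSω, abs_of_nonneg (Finset.sum_nonneg fun i _ => h0 i ω)]
    refine (Finset.sum_le_sum fun i _ => h1 i ω).trans ?_
    simp
  have hmgf : ∀ u : ℝ, |u| ≤ 1 → mgf S P u ≤ Real.exp (n * p * (u + u ^ 2)) := by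
    intro u hu
    rw [hind.mgf_sum hY]
    calc _ ≤ ∏ i ∈ Finset.range n, Real.exp (p * (u + u ^ 2)) := by
          refine Finset.prod_le_prod (fun i _ => mgf_nonneg) fun i _ => ?_
          rw [← hp i]
          exact mgf_le_of_mem_Icc (hY i) (h0 i) (h1 i) hu
      _ = _ := by
          rw [Finset.prod_const, Finset.card_range, ← Real.exp_nat_mul]
          ring_nf
  have hint : ∀ u : ℝ, Integrable (fun ω => Real.exp (u * S ω)) P := by
    intro u
    refine Integrable.of_bound (by fun_prop) (Real.exp (|u| * n)) (ae_of_all _ fun ω => ?_)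
    rw [Real.norm_of_nonneg (Real.exp_pos _).le, Real.exp_le_exp]
    calc u * S ω ≤ |u * S ω| := le_abs_self _
      _ = |u| * |S ω| := abs_mul _ _
      _ ≤ |u| * n := by gcongr; exact hS0 ω
  have hup : P.real {ω | n * p + a ≤ S ω} ≤ Real.exp (-(t * a) + n * p * t ^ 2) := by
    refine (measure_ge_le_exp_mul_mgf _ ht0 (hint t)).trans ?_
    calc _ ≤ Real.exp (-t * (n * p + a)) * Real.exp (n * p * (t + t ^ 2)) := by
          gcongr
          exact hmgf t (by rwa [abs_of_nonneg ht0])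
      _ = _ := by rw [← Real.exp_add]; ring_nf
  have hlo : P.real {ω | S ω ≤ n * p - a} ≤ Real.exp (-(t * a) + n * p * t ^ 2) := by
    refine (measure_le_le_exp_mul_mgf _ (neg_nonpos.2 ht0) (hint (-t))).trans ?_
    calc _ ≤ Real.exp (- -t * (n * p - a)) * Real.exp (n * p * (-t + (-t) ^ 2)) := by
          gcongr
          exact hmgf (-t) (by rwa [abs_neg, abs_of_nonneg ht0])
      _ = _ := by rw [← Real.exp_add]; ring_nf
  have hsub : {ω | a ≤ |∑ i ∈ Finset.range n, Y i ω - n * p|} ⊆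
      {ω | n * p + a ≤ S ω} ∪ {ω | S ω ≤ n * p - a} := by
    intro ω (hω : a ≤ |_|)
    rw [← hSω] at hω
    rcases le_abs.1 hω with h | h
    · left; rw [Set.mem_ofPred_eq]; linarith
    · right; rw [Set.mem_ofPred_eq]; linarith
  calc _ ≤ _ := measureReal_mono hsub
    _ ≤ _ := measureReal_union_le _ _
    _ ≤ _ := by linarith

/-- A Chernoff bound for sums over a sample from the law `μ`. -/
theorem measureReal_abs_sampleSum_sub_ge_le {E : Type*} [MeasurableSpace E] {μ : Measure E}
    {X : ℕ → Ω → E} (hX : ∀ i, Measurable (X i)) (hind : iIndepFun X P)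
    (hlaw : ∀ i, P.map (X i) = μ) {ξ : E → ℝ} (hξ : Measurable ξ) (h0 : ∀ z, 0 ≤ ξ z)
    (h1 : ∀ z, ξ z ≤ 1) (n : ℕ) (a : ℝ) {t : ℝ} (ht0 : 0 ≤ t) (ht1 : t ≤ 1) :
    P.real {ω | a ≤ |∑ i : Fin n, ξ (X i ω) - n * ∫ z, ξ z ∂μ|} ≤
      2 * Real.exp (-(t * a) + n * (∫ z, ξ z ∂μ) * t ^ 2) := by
  have h := measureReal_abs_sum_sub_ge_le (P := P) (Y := fun i ω => ξ (X i ω))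
    (fun i => hξ.comp (hX i)) (fun i ω => h0 _) (fun i ω => h1 _)
    (hind.comp (fun _ => ξ) fun _ => hξ) (p := ∫ z, ξ z ∂μ) (fun i => by
      rw [← hlaw i, integral_map (hX i).aemeasurable hξ.aestronglyMeasurable]) n a ht0 ht1
  simpa only [Finset.sum_range] using h

end Chernoff

/-! ### Packing and covering in Euclidean space. -/

section Covering

variable {d : ℕ}

/-- Balls of radius r / 2 about the points are disjoint and lie in a ball of radius R + r / 2;
compare volumes. -/
theorem card_le_of_separated {x₀ : RSpace d} {R r : ℝ} (hr : 0 < r) (hR : 0 ≤ R)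
    {F : Finset (RSpace d)} (hF : ∀ x ∈ F, dist x x₀ ≤ R)
    (hsep : (F : Set (RSpace d)).Pairwise fun x y => r < dist x y) :
    (F.card : ℝ) ≤ (2 * R / r + 1) ^ d := by
  have hdisj : (F : Set (RSpace d)).PairwiseDisjoint fun x => Metric.ball x (r / 2) := by
    intro x hx y hy hxy
    exact Metric.ball_disjoint_ball (by linarith [hsep hx hy hxy])
  have hsub : ⋃ x ∈ F, Metric.ball x (r / 2) ⊆ Metric.ball x₀ (R + r / 2) := by
    refine Set.iUnion₂_subset fun x hx => Metric.ball_subset_ball' ?_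
    linarith [hF x hx]
  have h := measureReal_mono (μ := (volume : Measure (RSpace d))) hsub
    measure_ball_lt_top.ne
  rw [measureReal_biUnion_finset hdisj (fun _ _ => measurableSet_ball)
    (fun _ _ => measure_ball_lt_top.ne)] at h
  have hb : ∀ (x : RSpace d) (s : ℝ), 0 < s → (volume : Measure (RSpace d)).real (Metric.ball x s) =
      s ^ d * (volume : Measure (RSpace d)).real (Metric.ball 0 1) := by
    intro x s hs
    rw [measureReal_def, measureReal_def, Measure.addHaar_ball_of_pos _ x hs, ENNReal.toReal_mul,
      ENNReal.toReal_ofReal (by positivity), finrank_euclideanSpace_fin]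
  simp only [hb _ _ (half_pos hr), hb _ _ (by positivity : 0 < R + r / 2), Finset.sum_const,
    nsmul_eq_mul, ← mul_assoc] at h
  have hv : 0 < (volume : Measure (RSpace d)).real (Metric.ball 0 1) :=
    ENNReal.toReal_pos (Metric.measure_ball_pos _ _ one_pos).ne' measure_ball_lt_top.ne
  have h2 := le_of_mul_le_mul_right h hv
  rw [← le_div_iff₀ (by positivity), ← div_pow] at h2
  refine h2.trans (le_of_eq ?_)
  congr 1
  field_simp

/-- A bounded set is covered by few balls of radius `r` with centres in the set. -/
theorem exists_finset_cover {x₀ : RSpace d} {R r : ℝ} (hr : 0 < r) (hR : 0 ≤ R)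
    {S : Set (RSpace d)} (hS : ∀ x ∈ S, dist x x₀ ≤ R) :
    ∃ F : Finset (RSpace d), (∀ x ∈ F, x ∈ S) ∧ (F.card : ℝ) ≤ (2 * R / r + 1) ^ d ∧
      ∀ x ∈ S, ∃ y ∈ F, dist x y ≤ r := by
  classical
  -- These are the cardinalities of r-separated subsets of S. A separated set of maximal cardinality
  -- covers S, since an uncovered point could be added to it.
  let A : Set ℕ := {m | ∃ F : Finset (RSpace d), (∀ x ∈ F, x ∈ S) ∧
    (F : Set (RSpace d)).Pairwise (fun x y => r < dist x y) ∧ F.card = m}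
  have hA0 : A.Nonempty := ⟨0, ∅, by simp⟩
  have hAb : BddAbove A := by
    refine ⟨⌊(2 * R / r + 1) ^ d⌋₊, ?_⟩
    rintro m ⟨F, hFS, hsep, rfl⟩
    exact Nat.le_floor (card_le_of_separated hr hR (fun x hx => hS x (hFS x hx)) hsep)
  obtain ⟨F, hFS, hsep, hcard⟩ := Nat.sSup_mem hA0 hAb
  refine ⟨F, hFS, card_le_of_separated hr hR (fun x hx => hS x (hFS x hx)) hsep, fun x hx => ?_⟩
  by_contra! hcon
  have hxF : x ∉ F := fun h => by
    have := hcon x h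
    rw [dist_self] at this
    linarith
  have hmem : F.card + 1 ∈ A := by
    refine ⟨insert x F, fun y hy => ?_, ?_, Finset.card_insert_of_notMem hxF⟩
    · rcases Finset.mem_insert.1 hy with rfl | hy
      exacts [hx, hFS y hy]
    · rw [Finset.coe_insert]
      exact hsep.insert fun y hy _ => ⟨hcon y hy, by rw [dist_comm]; exact hcon y hy⟩
  have := le_csSup hAb hmem
  omega

theorem exists_finset_theta_cover {r : ℝ} (hr : 0 < r) {R : ℝ} (hR : 0 ≤ R) {x₀ : RSpace d}
    {S : Set (Theta d)} (hS : ∀ x ∈ S, dist (x : RSpace d) x₀ ≤ R) :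
    ∃ F : Finset (Theta d), (F.card : ℝ) ≤ (2 * R / r + 1) ^ d ∧
      ∀ x ∈ S, ∃ y ∈ F, dist x y ≤ r := by
  classical
  obtain ⟨F, hF, hcard, hcov⟩ := exists_finset_cover (S := Subtype.val '' S) hr hR
    (by rintro _ ⟨x, hx, rfl⟩; exact hS x hx)
  have hFs : ∀ x ∈ F, x ∈ Metric.sphere (0 : RSpace d) 1 := fun x hx => by
    obtain ⟨y, -, rfl⟩ := hF x hx
    exact y.2
  let ι : F → Theta d := fun x => ⟨x.1, hFs x.1 x.2⟩
  refine ⟨Finset.univ.image ι, ?_, fun x hx => ?_⟩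
  · refine le_trans (Nat.cast_le.2 Finset.card_image_le) ?_
    rwa [Finset.card_univ, Fintype.card_coe]
  · obtain ⟨y, hy, hxy⟩ := hcov x ⟨x, hx, rfl⟩
    exact ⟨ι ⟨y, hy⟩, Finset.mem_image_of_mem _ (Finset.mem_univ _), hxy⟩

end Covering

/-! ### Surface area of spherical caps. -/

section Cap

variable {d : ℕ}

theorem norm_theta (v : Theta d) : ‖(v : RSpace d)‖ = 1 := by simp

theorem dist_sq_theta (v w : Theta d) :
    dist v w ^ 2 = 2 * (1 - ⟪(v : RSpace d), (w : RSpace d)⟫) := by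
  rw [Subtype.dist_eq, dist_eq_norm, norm_sub_sq_real, norm_theta, norm_theta]
  ring

/-- For unit vectors |v - w|² = 2 (1 - ⟨v, w⟩), so caps are balls of the chordal distance. -/
theorem mem_sphericalCap_iff {v w : Theta d} {h : ℝ} (hh : 0 ≤ h) :
    v ∈ sphericalCap w h ↔ dist v w ≤ √(2 * h) := by
  rw [Real.le_sqrt dist_nonneg (by positivity), dist_sq_theta, real_inner_comm]
  change 1 - h ≤ _ ↔ _
  constructor <;> intro h <;> linarith

theorem isClosed_sphericalCap (w : Theta d) (h : ℝ) : IsClosed (sphericalCap w h) :=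
  isClosed_le continuous_const (by fun_prop)

theorem measurableSet_sphericalCap (w : Theta d) (h : ℝ) : MeasurableSet (sphericalCap w h) :=
  (isClosed_sphericalCap w h).measurableSet

theorem measure_sphericalCap_eq (w w' : Theta d) (h : ℝ) :
    surfaceArea d (sphericalCap w h) = surfaceArea d (sphericalCap w' h) := by
  obtain ⟨e, he⟩ : ∃ e : RSpace d ≃ₗᵢ[ℝ] RSpace d, e w = w' :=
    ⟨_, Submodule.reflection_sub (v := (w : RSpace d)) (w := (w' : RSpace d)) (by simp)⟩
  rw [← (measurePreserving_sphere e).measure_preimage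
    (measurableSet_sphericalCap w' h).nullMeasurableSet]
  congr 1
  ext v
  change 1 - h ≤ ⟪(w : RSpace d), (v : RSpace d)⟫ ↔ 1 - h ≤ ⟪(w' : RSpace d), e v⟫
  rw [← he, e.inner_map_map]

theorem measureReal_sphericalCap_pos (w : Theta d) {h : ℝ} (hh : 0 < h) :
    0 < (surfaceArea d).real (sphericalCap w h) := by
  refine ENNReal.toReal_pos (ne_of_gt ?_) (measure_ne_top _ _)
  have hsub : Metric.ball w (√(2 * h)) ⊆ sphericalCap w h := fun v hv =>
    (mem_sphericalCap_iff hh.le).2 (Metric.mem_ball.1 hv).le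
  exact (Metric.measure_ball_pos _ w (by positivity)).trans_le (measure_mono hsub)

/-- The surface area measure is doubling. -/
theorem measureReal_sphericalCap_mul_le (w : Theta d) {h M : ℝ} (hh : 0 < h) (hM : 0 ≤ M) :
    (surfaceArea d).real (sphericalCap w (M * h)) ≤
      (2 * √M + 1) ^ d * (surfaceArea d).real (sphericalCap w h) := by
  have hr : 0 < √(2 * h) := by positivity
  -- The large cap has chordal radius √M √(2h), so at most (2√M + 1)^d caps of height h cover it,
  -- all of equal area by rotation invariance.
  obtain ⟨F, hcard, hcov⟩ := exists_finset_theta_cover (d := d) (S := sphericalCap w (M * h))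
    (R := √M * √(2 * h)) (x₀ := w) hr (by positivity) (fun v hv => by
      have := (mem_sphericalCap_iff (by positivity)).1 hv
      rwa [mul_left_comm, Real.sqrt_mul hM] at this)
  have hsub : sphericalCap w (M * h) ⊆ ⋃ y ∈ F, sphericalCap y h := fun v hv => by
    obtain ⟨y, hy, hvy⟩ := hcov v hv
    exact Set.mem_iUnion₂.2 ⟨y, hy, (mem_sphericalCap_iff hh.le).2 hvy⟩
  calc _ ≤ (surfaceArea d).real (⋃ y ∈ F, sphericalCap y h) := measureReal_mono hsub (measure_ne_top _ _)
    _ ≤ ∑ y ∈ F, (surfaceArea d).real (sphericalCap y h) := measureReal_biUnion_finset_le _ _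
    _ = F.card * (surfaceArea d).real (sphericalCap w h) := by
        simp only [measureReal_def, measure_sphericalCap_eq _ w, Finset.sum_const, nsmul_eq_mul]
    _ ≤ _ := by
        gcongr
        refine hcard.trans (le_of_eq ?_)
        congr 1
        field_simp

open scoped Pointwise in
/-- In dimension at least two, small caps have small surface area. -/
theorem measureReal_sphericalCap_le (hd : 2 ≤ d) (w : Theta d) {h : ℝ} (h0 : 0 < h) (h1 : h < 1) :
    (surfaceArea d).real (sphericalCap w h) ≤ d * 2 ^ d * √(2 * h) := by
  let i0 : Fin d := ⟨0, by omega⟩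
  let i1 : Fin d := ⟨1, by omega⟩
  have h01 : i0 ≠ i1 := by simp [i0, i1]
  let e : Theta d := ⟨EuclideanSpace.single i0 1, by simp⟩
  -- The cone over the cap about `e` lies in a box that is thin in the direction `i1` orthogonal to
  -- `e`, where v² ≤ 1 - (1 - h)² ≤ 2h. Surface area is d times the volume of the cone. The power √h
  -- is crude, but a polynomial bound on the grid needs no more.
  let b : Fin d → ℝ := fun i => if i = i1 then √(2 * h) else 1
  have hb : ∀ i, 0 ≤ b i := fun i => by simp only [b]; split_ifs <;> positivity
  let B : Set (RSpace d) := {z | ∀ i, |z i| ≤ b i}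
  have hB : volume B = ENNReal.ofReal (2 ^ d * √(2 * h)) := by
    have hpre : B = (MeasurableEquiv.toLp 2 (Fin d → ℝ)).symm ⁻¹' Set.Icc (-b) b := by
      ext z
      simp only [B, Set.mem_ofPred_eq, Set.mem_preimage, Set.mem_Icc, Pi.le_def, ← forall_and]
      exact forall_congr' fun i => abs_le
    rw [hpre, (EuclideanSpace.volume_preserving_symm_measurableEquiv_toLp (Fin d)).measure_preimage
      measurableSet_Icc.nullMeasurableSet, Real.volume_Icc_pi,
      ← ENNReal.ofReal_prod_of_nonneg]
    · congr 1
      simp only [Pi.neg_apply, sub_neg_eq_add, ← two_mul]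
      rw [Finset.prod_mul_distrib]
      simp [b]
    · intro i _
      simp only [Pi.neg_apply]
      linarith [hb i]
  have hsub : Set.Ioo (0 : ℝ) 1 • (Subtype.val '' sphericalCap e h : Set (RSpace d)) ⊆ B := by
    rintro _ ⟨r, hr, _, ⟨v, hv, rfl⟩, rfl⟩ i
    have hvi : |(v : RSpace d) i| ≤ b i := by
      have hv0 : 1 - h ≤ (v : RSpace d) i0 := by
        have : 1 - h ≤ ⟪(e : RSpace d), (v : RSpace d)⟫ := hv
        simpa [e, EuclideanSpace.inner_single_left] using this
      have hsum : ∑ j, (v : RSpace d) j ^ 2 = 1 := by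
        have := EuclideanSpace.real_norm_sq_eq (v : RSpace d)
        rw [norm_theta] at this
        linarith
      by_cases hi : i = i1
      · subst hi
        simp only [b, if_pos]
        refine Real.abs_le_sqrt ?_
        have h2 : (v : RSpace d) i0 ^ 2 + (v : RSpace d) i1 ^ 2 ≤ ∑ j, (v : RSpace d) j ^ 2 := by
          rw [← Finset.sum_pair (f := fun j => (v : RSpace d) j ^ 2) h01]
          exact Finset.sum_le_sum_of_subset_of_nonneg (Finset.subset_univ _)
            fun _ _ _ => sq_nonneg _
        nlinarith
      · simp only [b, if_neg hi]
        have := PiLp.norm_apply_le (v : RSpace d) i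
        rwa [norm_theta, Real.norm_eq_abs] at this
    change |r * (v : RSpace d) i| ≤ b i
    rw [abs_mul, abs_of_pos hr.1]
    nlinarith [abs_nonneg ((v : RSpace d) i), hr.2, hr.1]
  rw [measureReal_def, measure_sphericalCap_eq w e,
    Measure.toSphere_apply' _ (measurableSet_sphericalCap e h), finrank_euclideanSpace_fin,
    ENNReal.toReal_mul, ENNReal.toReal_natCast, mul_assoc]
  gcongr
  refine ENNReal.toReal_le_of_le_ofReal (by positivity) ?_
  rw [← hB]
  exact measure_mono hsub

end Cap

/-! ### The kernel, its normalising constant, and grids on the sphere. -/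

section Kernel

variable {K : unitInterval → unitInterval}

theorem kernelValue_nonneg (K : unitInterval → unitInterval) (u : ℝ) : 0 ≤ kernelValue K u :=
  (Set.IccExtend zero_le_one K u).2.1

theorem kernelValue_le_one (K : unitInterval → unitInterval) (u : ℝ) : kernelValue K u ≤ 1 :=
  (Set.IccExtend zero_le_one K u).2.2

theorem kernelValue_of_one_le (hK1 : K 1 = 0) {u : ℝ} (hu : 1 ≤ u) : kernelValue K u = 0 := by
  unfold kernelValue
  rw [Set.IccExtend_of_right_le _ _ hu]
  change ((K 1 : unitInterval) : ℝ) = 0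
  rw [hK1]; rfl

theorem kernelValue_zero (hK0 : K 0 = 1) : kernelValue K 0 = 1 := by
  unfold kernelValue
  rw [Set.IccExtend_of_le_left _ _ le_rfl]
  change ((K 0 : unitInterval) : ℝ) = 1
  rw [hK0]; rfl

theorem antitone_kernelValue (hK : Antitone K) : Antitone (kernelValue K) := fun _ _ h =>
  hK (Set.monotone_projIcc zero_le_one h)

theorem uniformContinuous_kernelValue (hK : Continuous K) : UniformContinuous (kernelValue K) :=
  uniformContinuous_subtype_val.comp ((CompactSpace.uniformContinuous_of_continuous hK).comp
    (LipschitzWith.projIcc zero_le_one).uniformContinuous)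

/-- The weight that the kernel with centre `w` and bandwidth `h` gives to the direction `z`. -/
noncomputable def kernelWeight {d : ℕ} (K : unitInterval → unitInterval) (h : ℝ) (w : Theta d)
    (z : RSpace d) : ℝ :=
  kernelValue K ((1 - ⟪(w : RSpace d), z⟫) / h)

variable {d : ℕ} {h : ℝ} {w : Theta d}

theorem kernelWeight_nonneg (z : RSpace d) : 0 ≤ kernelWeight K h w z := kernelValue_nonneg _ _

theorem kernelWeight_le_one (z : RSpace d) : kernelWeight K h w z ≤ 1 := kernelValue_le_one _ _

theorem continuous_kernelWeight (hK : Continuous K) : Continuous (kernelWeight K h w) := by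
  have := (uniformContinuous_kernelValue hK).continuous
  unfold kernelWeight
  fun_prop

theorem kernelWeight_eq_zero (hK1 : K 1 = 0) (hh : 0 < h) {v : Theta d}
    (hv : v ∉ sphericalCap w h) : kernelWeight K h w v = 0 := by
  refine kernelValue_of_one_le hK1 ?_
  have : ¬ (1 - h ≤ ⟪(w : RSpace d), (v : RSpace d)⟫) := hv
  rw [le_div_iff₀ hh]
  linarith

theorem kernelConst_eq_inv_integral (hK1 : K 1 = 0) (hh : 0 < h) (w : Theta d) :
    kernelConst h K w = (∫ v : Theta d, kernelWeight K h w v ∂surfaceArea d)⁻¹ := by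
  unfold kernelConst
  congr 1
  rw [← setIntegral_eq_integral_of_forall_compl_eq_zero (s := sphericalCap w h)
    fun v hv => kernelWeight_eq_zero hK1 hh hv]
  simp only [kernelWeight, real_inner_comm]

theorem integrable_kernelWeight (hK : Continuous K) :
    Integrable (fun v : Theta d => kernelWeight K h w v) (surfaceArea d) :=
  integrable_theta ((continuous_kernelWeight hK).comp continuous_subtype_val)

theorem integral_kernelWeight_le (hK : Continuous K) (hK1 : K 1 = 0) (hh : 0 < h) :
    ∫ v : Theta d, kernelWeight K h w v ∂surfaceArea d ≤
      (surfaceArea d).real (sphericalCap w h) := by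
  rw [← integral_indicator_one (measurableSet_sphericalCap w h)]
  refine integral_mono (integrable_kernelWeight hK)
    ((integrable_const _).indicator (measurableSet_sphericalCap w h)) fun v => ?_
  by_cases hv : v ∈ sphericalCap w h
  · simpa [hv] using kernelWeight_le_one (v : RSpace d)
  · simp [hv, kernelWeight_eq_zero hK1 hh hv]

/-- The kernel is at least 1/2 on a cap of height (δ / 2) h, and doubling with M = 4 / δ compares
that cap with the one of height 2h. -/
theorem exists_measureReal_sphericalCap_le_integral_kernelWeight (hK : Continuous K)
    (hKa : Antitone K) (hK0 : K 0 = 1) :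
    ∃ D : ℝ, 0 < D ∧ ∀ (h : ℝ) (w : Theta d), 0 < h →
      (surfaceArea d).real (sphericalCap w (2 * h)) ≤
        D * ∫ v : Theta d, kernelWeight K h w v ∂surfaceArea d := by
  obtain ⟨δ, hδ, hδ'⟩ := Metric.uniformContinuous_iff.1 (uniformContinuous_kernelValue hK)
    (1 / 2) (by norm_num)
  have hhalf : 1 / 2 ≤ kernelValue K (δ / 2) := by
    have := hδ' (a := δ / 2) (b := 0) (by rw [Real.dist_eq, sub_zero, abs_of_pos] <;> linarith)
    rw [kernelValue_zero hK0, Real.dist_eq] at this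
    linarith [(abs_lt.1 this).1]
  refine ⟨(2 * √(4 / δ) + 1) ^ d * 2, by positivity, fun h w hh => ?_⟩
  have h1 := measureReal_sphericalCap_mul_le w (h := δ / 2 * h) (M := 4 / δ) (by positivity)
    (by positivity)
  rw [show 4 / δ * (δ / 2 * h) = 2 * h by field_simp; norm_num] at h1
  refine h1.trans ?_
  rw [mul_assoc]
  gcongr
  rw [← integral_indicator_one (measurableSet_sphericalCap w (δ / 2 * h)), ← integral_const_mul]
  refine integral_mono ((integrable_const _).indicator (measurableSet_sphericalCap w _))
    ((integrable_kernelWeight hK).const_mul _) fun v => ?_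
  by_cases hv : v ∈ sphericalCap w (δ / 2 * h)
  · have h2 : (1 - ⟪(w : RSpace d), (v : RSpace d)⟫) / h ≤ δ / 2 := by
      have : 1 - δ / 2 * h ≤ ⟪(w : RSpace d), (v : RSpace d)⟫ := hv
      rw [div_le_iff₀ hh]
      linarith
    have h3 : kernelValue K (δ / 2) ≤ kernelWeight K h w v := antitone_kernelValue hKa h2
    simp only [hv, Set.indicator_of_mem, Pi.one_apply]
    linarith
  · simpa [hv] using kernelWeight_nonneg (v : RSpace d)

theorem integral_kernelWeight_pos (hK : Continuous K) (hKa : Antitone K) (hK0 : K 0 = 1)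
    (hh : 0 < h) (w : Theta d) : 0 < ∫ v : Theta d, kernelWeight K h w v ∂surfaceArea d := by
  obtain ⟨D, hD, hle⟩ := exists_measureReal_sphericalCap_le_integral_kernelWeight (d := d) hK hKa hK0
  have h1 := measureReal_sphericalCap_pos w (h := 2 * h) (by positivity)
  exact pos_of_mul_pos_right (h1.trans_le (hle h w hh)) hD.le

/-- For d = 1 the sphere consists of two points at distance 2, so a cover of radius 1 already
contains every point. -/
theorem eq_of_dist_theta_one {v w : Theta 1} (hvw : dist v w ≤ 1) : v = w := by
  have hs : ∀ v : Theta 1, (v : RSpace 1) 0 ^ 2 = 1 := fun v => by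
    have := EuclideanSpace.real_norm_sq_eq (v : RSpace 1)
    rw [norm_theta] at this
    simpa using this.symm
  rw [Subtype.dist_eq, EuclideanSpace.dist_eq] at hvw
  simp only [Finset.univ_unique, Fin.default_eq_zero, Finset.sum_singleton] at hvw
  rw [Real.sqrt_sq dist_nonneg, Real.dist_eq] at hvw
  have h1 := hs v
  have h2 := hs w
  have h3 := abs_le.1 hvw
  refine Subtype.ext ?_
  ext i
  rw [Fin.fin_one_eq_zero i]
  rcases mul_self_eq_one_iff.1 ((sq _).symm.trans h1) with h | h <;>
  rcases mul_self_eq_one_iff.1 ((sq _).symm.trans h2) with h' | h' <;> rw [h, h'] at h3 ⊢ <;> norm_num at h3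

/-- The sphere has a grid of mesh proportional to the bandwidth with polynomially many points in
terms of the normalising constant of the kernel. -/
theorem exists_grid (hd : 1 ≤ d) (hK : Continuous K) (hKa : Antitone K) (hK0 : K 0 = 1)
    (hK1 : K 1 = 0) {δ : ℝ} (hδ : 0 < δ) :
    ∃ C : ℝ, 0 < C ∧ ∀ (h : ℝ) (w : Theta d), 0 < h → h < 1 →
      ∃ F : Finset (Theta d), (F.card : ℝ) ≤ C * kernelConst h K w ^ (2 * d) ∧
        ∀ v, ∃ y ∈ F, dist v y ≤ δ * h := by
  have hone : ∀ x ∈ (Set.univ : Set (Theta d)), dist (x : RSpace d) 0 ≤ 1 := fun x _ => by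
    rw [dist_zero_right, norm_theta]
  have hcap : ∀ (h : ℝ) (w : Theta d), 0 < h → 0 < kernelConst h K w ∧
      1 ≤ (surfaceArea d).real (sphericalCap w h) * kernelConst h K w := by
    intro h w hh
    have hI := integral_kernelWeight_pos hK hKa hK0 hh w
    rw [kernelConst_eq_inv_integral hK1 hh]
    refine ⟨inv_pos.2 hI, ?_⟩
    rw [← div_eq_mul_inv, one_le_div hI]
    exact integral_kernelWeight_le hK hK1 hh
  -- In dimension one the cardinality is at most 3, and c is bounded below. In higher dimensions a
  -- grid of mesh δ h has order h^(-d) points, and 1 ≤ c · area of the cap ≤ A √h c bounds 1 / h by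
  -- (A c)²; hence the exponent 2d.
  rcases hd.eq_or_lt with rfl | hd2
  · set L := (surfaceArea 1).real Set.univ
    have hL : 0 < L := ENNReal.toReal_pos
      (Measure.measure_univ_ne_zero.2 (surfaceArea_ne_zero le_rfl)) (measure_ne_top _ _)
    refine ⟨3 * L ^ 2, by positivity, fun h w hh _ => ?_⟩
    obtain ⟨hc, h1⟩ := hcap h w hh
    have h2 : 1 ≤ L * kernelConst h K w :=
      h1.trans (mul_le_mul_of_nonneg_right (measureReal_mono (Set.subset_univ _)) hc.le)
    obtain ⟨F, hF, hcov⟩ := exists_finset_theta_cover one_pos zero_le_one hone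
    refine ⟨F, ?_, fun v => ?_⟩
    · have h3 : 1 ≤ (L * kernelConst h K w) ^ 2 := one_le_pow₀ h2
      have hF3 : (F.card : ℝ) ≤ 3 := hF.trans_eq (by norm_num)
      calc (F.card : ℝ) ≤ 3 * 1 := by linarith
        _ ≤ 3 * (L * kernelConst h K w) ^ 2 := by gcongr
        _ = _ := by ring
    · obtain ⟨y, hy, hvy⟩ := hcov v trivial
      refine ⟨y, hy, ?_⟩
      rw [eq_of_dist_theta_one hvy, dist_self]
      positivity
  · set A : ℝ := d * 2 ^ d * √2
    have hA : 0 < A := by positivity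
    refine ⟨((2 / δ + 1) * A ^ 2) ^ d, by positivity, fun h w hh hh1 => ?_⟩
    obtain ⟨hc, h1⟩ := hcap h w hh
    have h2 : 1 ≤ A * √h * kernelConst h K w := by
      refine h1.trans (mul_le_mul_of_nonneg_right ?_ hc.le)
      refine (measureReal_sphericalCap_le hd2 w hh hh1).trans (le_of_eq ?_)
      rw [Real.sqrt_mul zero_le_two]
      ring
    have h3 : 1 / h ≤ (A * kernelConst h K w) ^ 2 := by
      have h4 : 1 ≤ (A * √h * kernelConst h K w) ^ 2 := one_le_pow₀ h2
      rw [div_le_iff₀ hh]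
      calc (1 : ℝ) ≤ _ := h4
        _ = (A * kernelConst h K w) ^ 2 * √h ^ 2 := by ring
        _ = _ := by rw [Real.sq_sqrt hh.le]
    obtain ⟨F, hF, hcov⟩ := exists_finset_theta_cover (mul_pos hδ hh) zero_le_one hone
    refine ⟨F, hF.trans ?_, fun v => hcov v trivial⟩
    calc (2 * 1 / (δ * h) + 1) ^ d ≤ ((2 / δ + 1) * (1 / h)) ^ d := by
          gcongr
          have : 1 ≤ 1 / h := (one_le_div hh).2 hh1.le
          calc 2 * 1 / (δ * h) + 1 = 2 / δ * (1 / h) + 1 := by field_simp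
            _ ≤ _ := by linarith
      _ ≤ ((2 / δ + 1) * (A * kernelConst h K w) ^ 2) ^ d := by gcongr
      _ = _ := by rw [pow_mul, ← mul_pow]; ring

end Kernel

/-! ### Order statistics and counts of exceedances. -/

section OrderStatistic

variable {n k : ℕ} {R : Fin n → ℝ} {s : ℝ}

/-- The value sits at zero-based position n - k - 1 of the sorted sample. If it exceeded s, so would
the k + 1 values from that position on. -/
theorem orderStatistic_le_of_card_le (hk : k < n)
    (hs : (Finset.univ.filter fun i => s < R i).card ≤ k) : orderStatistic R (n - k) ≤ s := by
  rw [orderStatistic, dif_pos ⟨by omega, by omega⟩]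
  by_contra! hcon
  have hsub : (Finset.Ici (⟨n - k - 1, by omega⟩ : Fin n)).map (Tuple.sort R).toEmbedding ⊆
      Finset.univ.filter fun i => s < R i := by
    intro i hi
    obtain ⟨j, hj, rfl⟩ := Finset.mem_map.1 hi
    exact Finset.mem_filter.2 ⟨Finset.mem_univ _,
      hcon.trans_le (Tuple.monotone_sort R (Finset.mem_Ici.1 hj))⟩
  have := Finset.card_le_card hsub
  rw [Finset.card_map, Fin.card_Ici] at this
  simp only at this
  omega

/-- If the value were below s, only the k strictly later positions could exceed s. -/
theorem le_orderStatistic_of_lt_card (hk : k < n)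
    (hs : k < (Finset.univ.filter fun i => s < R i).card) : s ≤ orderStatistic R (n - k) := by
  rw [orderStatistic, dif_pos ⟨by omega, by omega⟩]
  by_contra! hcon
  have hsub : Finset.univ.filter (fun i => s < R i) ⊆
      (Finset.Ioi (⟨n - k - 1, by omega⟩ : Fin n)).map (Tuple.sort R).toEmbedding := by
    intro i hi
    refine Finset.mem_map.2 ⟨(Tuple.sort R).symm i, Finset.mem_Ioi.2 ?_, by simp⟩
    by_contra! hle
    have h1 := Tuple.monotone_sort R hle
    simp only [Function.comp, Equiv.apply_symm_apply] at h1
    linarith [(Finset.mem_filter.1 hi).2]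
  have := Finset.card_le_card hsub
  rw [Finset.card_map, Fin.card_Ioi] at this
  simp only at this
  omega

end OrderStatistic

/-! ### Deterministic thresholds with prescribed tail probability. -/

section Threshold

variable {d : ℕ} {f q : RSpace d → ℝ} {α : ℝ} {V : ℝ → ℝ} [IsProbabilityMeasure (densityMeasure f)]

theorem DensityRegularVariation.tendsto_tail_and_continuousOn (hd : 1 ≤ d)
    (hf : DensityRegularVariation f α q V) :
    Tendsto (fun s : ℝ => (densityMeasure f).real {z | s < ‖z‖}) atTop (𝓝 0) ∧
      ContinuousOn (fun s : ℝ => (densityMeasure f).real {z | s < ‖z‖}) (Set.Ici 0) := by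
  set u : ℝ → ℝ := fun r => r ^ (d - 1) * sphereIntegral f r
  have hu : Continuous u := by
    have := continuous_sphereIntegral hf.continuous_density
    fun_prop
  have hi := hf.integrableOn_sphereIntegral hd le_rfl
  have hG : ∀ s : ℝ, 0 ≤ s → (densityMeasure f).real {z | s < ‖z‖} =
      (∫ r in Set.Ioi 0, u r) - ∫ r in (0 : ℝ)..s, u r := by
    intro s hs
    rw [hf.measureReal_norm_gt hd hs, ← intervalIntegral.integral_Ioi_sub_Ioi hi hs, sub_sub_cancel]
  constructor
  · have h1 := (intervalIntegral_tendsto_integral_Ioi 0 hi tendsto_id).const_sub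
      (∫ r in Set.Ioi 0, u r)
    rw [sub_self] at h1
    refine h1.congr' ?_
    filter_upwards [eventually_ge_atTop 0] with s hs
    exact (hG s hs).symm
  · have h2 : Continuous fun s => (∫ r in Set.Ioi 0, u r) - ∫ r in (0 : ℝ)..s, u r :=
      continuous_const.sub (intervalIntegral.continuous_primitive
        (fun a b => hu.intervalIntegrable a b) 0)
    exact h2.continuousOn.congr fun s hs => hG s hs

/-- The tail is continuous and tends to 0, so the intermediate value theorem attains every small
level. It stays positive on bounded sets, which drives the thresholds to infinity; 0 serves as
threshold where the level is out of range. -/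
theorem DensityRegularVariation.exists_threshold (hd : 1 ≤ d)
    (hf : DensityRegularVariation f α q V) {p : ℕ → ℝ} (hp : ∀ᶠ n in atTop, 0 < p n)
    (hp0 : Tendsto p atTop (𝓝 0)) :
    ∃ s : ℕ → ℝ, (∀ n, 0 ≤ s n) ∧ Tendsto s atTop atTop ∧
      ∀ᶠ n in atTop, (densityMeasure f).real {z | s n < ‖z‖} = p n := by
  set G : ℝ → ℝ := fun s => (densityMeasure f).real {z | s < ‖z‖}
  obtain ⟨hG0, hGc⟩ := hf.tendsto_tail_and_continuousOn hd
  have hGanti : Antitone G := fun a b hab => measureReal_mono fun z (hz : b < ‖z‖) =>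
    hab.trans_lt hz
  have hex : ∀ y, 0 < y → y < G 0 → ∃ s, 0 ≤ s ∧ G s = y := by
    intro y hy hy0
    obtain ⟨b, hb, hb0⟩ := ((hG0.eventually_lt_const hy).and (eventually_ge_atTop 0)).exists
    obtain ⟨s, hs, hs'⟩ := intermediate_value_Icc' hb0 (hGc.mono fun x hx => hx.1)
      ⟨hb.le, hy0.le⟩
    exact ⟨s, hs.1, hs'⟩
  have hex' : ∀ n, ∃ s, 0 ≤ s ∧ (0 < p n → p n < G 0 → G s = p n) := by
    intro n
    by_cases h : 0 < p n ∧ p n < G 0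
    · obtain ⟨s, hs, hs'⟩ := hex _ h.1 h.2
      exact ⟨s, hs, fun _ _ => hs'⟩
    · exact ⟨0, le_rfl, fun h1 h2 => absurd ⟨h1, h2⟩ h⟩
  choose s hs hs' using hex'
  have hev : ∀ᶠ n in atTop, G (s n) = p n := by
    filter_upwards [hp, hp0.eventually_lt_const (hf.measureReal_norm_gt_pos hd le_rfl)] with n h1 h2
    exact hs' n h1 h2
  refine ⟨s, hs, tendsto_atTop.2 fun b => ?_, hev⟩
  have hb := hf.measureReal_norm_gt_pos hd (le_max_right b 0)
  filter_upwards [hev, hp0.eventually_lt_const hb] with n h1 h2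
  by_contra! hlt
  have : G (max b 0) ≤ G (s n) := hGanti (hlt.le.trans (le_max_left _ _))
  rw [h1] at this
  exact absurd h2 (not_lt.2 this)

end Threshold

/-! ### Exceedances and their concentration. -/

section Exceedance

/-- The value of `φ` at the direction of `z` if the radius of `z` exceeds `s`, and `0` otherwise. -/
noncomputable def exceedance {d : ℕ} (φ : RSpace d → ℝ) (s : ℝ) (z : RSpace d) : ℝ :=
  {z : RSpace d | s < ‖z‖}.indicator (fun z => φ (‖z‖⁻¹ • z)) z

variable {d : ℕ} {φ : RSpace d → ℝ} {s : ℝ}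

theorem measurableSet_norm_gt : MeasurableSet {z : RSpace d | s < ‖z‖} :=
  measurableSet_lt measurable_const measurable_norm

theorem measurable_exceedance (hφ : Measurable φ) : Measurable (exceedance φ s) :=
  (hφ.comp (by fun_prop)).indicator measurableSet_norm_gt

theorem exceedance_nonneg (hφ : ∀ z, 0 ≤ φ z) (z : RSpace d) : 0 ≤ exceedance φ s z :=
  Set.indicator_nonneg (fun _ _ => hφ _) z

theorem exceedance_le_one (hφ : ∀ z, φ z ≤ 1) (z : RSpace d) : exceedance φ s z ≤ 1 :=
  Set.indicator_le' (fun _ _ => hφ _) (fun _ _ => zero_le_one) z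

theorem exceedance_anti (hφ : ∀ z, 0 ≤ φ z) {s' : ℝ} (hs : s ≤ s') (z : RSpace d) :
    exceedance φ s' z ≤ exceedance φ s z :=
  Set.indicator_le_indicator_of_subset (fun _ (hz : s' < _) => hs.trans_lt hz) (fun _ => hφ _) z

theorem integral_exceedance (μ : Measure (RSpace d)) :
    ∫ z, exceedance φ s z ∂μ = ∫ z in {z | s < ‖z‖}, φ (‖z‖⁻¹ • z) ∂μ :=
  integral_indicator measurableSet_norm_gt

/-- Exponential concentration for sums of exceedances with mean of order at most `m`. -/
theorem exists_exceedance_concentration {Ω : Type*} [MeasurableSpace Ω] {P : Measure Ω}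
    [IsProbabilityMeasure P] {μ : Measure (RSpace d)} {X : ℕ → Ω → RSpace d}
    (hX : ∀ i, Measurable (X i)) (hind : iIndepFun X P) (hlaw : ∀ i, P.map (X i) = μ)
    {ε B : ℝ} (hε : 0 < ε) (hB : 0 < B) :
    ∃ κ, 0 < κ ∧ ∀ (φ : RSpace d → ℝ) (s m : ℝ) (n : ℕ), Measurable φ → (∀ z, 0 ≤ φ z) →
      (∀ z, φ z ≤ 1) → 0 ≤ m → n * ∫ z, exceedance φ s z ∂μ ≤ B * m →
      P.real {ω | ε * m ≤ |∑ i : Fin n, exceedance φ s (X i ω) - n * ∫ z, exceedance φ s z ∂μ|} ≤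
        2 * Real.exp (-(κ * m)) := by
  -- Then t B ≤ ε / 2, so the quadratic term B m t² uses at most half of the linear gain t ε m. The
  -- rate depends on ε and B only, hence is uniform over the grid.
  set t := min 1 (ε / (2 * B))
  have ht : 0 < t := by positivity
  refine ⟨t * ε / 2, by positivity, fun φ s m n hφ h0 h1 hm hp => ?_⟩
  refine (measureReal_abs_sampleSum_sub_ge_le hX hind hlaw (measurable_exceedance hφ)
    (exceedance_nonneg h0) (exceedance_le_one h1) n (ε * m) ht.le (min_le_left _ _)).trans ?_
  gcongr
  have h2 : t * B ≤ ε / 2 := by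
    calc t * B ≤ ε / (2 * B) * B := by gcongr; exact min_le_right _ _
      _ = ε / 2 := by field_simp
  have h3 : n * (∫ z, exceedance φ s z ∂μ) * t ^ 2 ≤ B * m * t ^ 2 := by gcongr
  have h4 : B * m * t ^ 2 ≤ t * ε / 2 * m := by
    have : t * B * (m * t) ≤ ε / 2 * (m * t) := by gcongr
    linarith
  linarith

end Exceedance

/-! ### The exponential bound against the size of the grid. -/

section Rate

/-- Eventually κ k / c ≥ (p + 1) log k, so the exponential is at most k^(-(p + 1)). Also c ≤ k
eventually, and the product is at most 1 / k. -/
theorem tendsto_pow_mul_exp_neg {k : ℕ → ℕ} (hk : Tendsto k atTop atTop) {c : ℕ → ℝ}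
    (hc : ∀ n, 0 < c n)
    (hkc : Tendsto (fun n => (k n : ℝ) / (c n * Real.log (k n))) atTop atTop) (p : ℕ) {κ : ℝ}
    (hκ : 0 < κ) :
    Tendsto (fun n => c n ^ p * Real.exp (-(κ * (k n / c n)))) atTop (𝓝 0) := by
  have hkr : Tendsto (fun n => (k n : ℝ)) atTop atTop := tendsto_natCast_atTop_atTop.comp hk
  refine squeeze_zero' (Eventually.of_forall fun n => by have := hc n; positivity) ?_
    (tendsto_inv_atTop_zero.comp hkr)
  filter_upwards [hkc.eventually_ge_atTop ((p + 1) / κ), hkc.eventually_ge_atTop 1,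
    (Real.tendsto_log_atTop.comp hkr).eventually_ge_atTop 1, hkr.eventually_gt_atTop 0]
    with n h1 h2 h3 h4
  have hcn := hc n
  change 1 ≤ Real.log (k n) at h3
  have hl : 0 < Real.log (k n) := by linarith
  rw [le_div_iff₀ (by positivity)] at h1 h2
  have hck : c n ≤ k n := by nlinarith
  have hexp : Real.exp (-(κ * (k n / c n))) ≤ ((k n : ℝ) ^ (p + 1))⁻¹ := by
    rw [← Real.exp_log (by positivity : 0 < ((k n : ℝ) ^ (p + 1))⁻¹), Real.exp_le_exp,
      Real.log_inv, Real.log_pow, neg_le_neg_iff]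
    rw [← mul_div_assoc, le_div_iff₀ hcn]
    calc _ = κ * ((p + 1) / κ * (c n * Real.log (k n))) := by push_cast; field_simp
      _ ≤ _ := by gcongr
  calc c n ^ p * Real.exp (-(κ * (k n / c n))) ≤ (k n : ℝ) ^ p * ((k n : ℝ) ^ (p + 1))⁻¹ := by
        gcongr
    _ = _ := by simp only [Function.comp]; field_simp; ring

end Rate

/-! ### Means of kernel sums and of cap counts. -/

section Mean

variable {d : ℕ} {f q : RSpace d → ℝ} {α : ℝ} {V : ℝ → ℝ} [IsProbabilityMeasure (densityMeasure f)]
  {K : unitInterval → unitInterval} {k : ℕ → ℕ} {h s : ℕ → ℝ} {θ : ℝ}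

theorem integral_kernelWeight_eq_inv (hK1 : K 1 = 0) {h : ℝ} (hh : 0 < h) (w w₀ : Theta d) :
    ∫ v : Theta d, kernelWeight K h w v ∂surfaceArea d = (kernelConst h K w₀)⁻¹ := by
  rw [kernelConst_eq h K w₀ w, kernelConst_eq_inv_integral hK1 hh, inv_inv]

/-- The indicator function of a cap, extended to the whole space. -/
noncomputable def capIndicator (h : ℝ) (w : Theta d) (z : RSpace d) : ℝ :=
  {z : RSpace d | 1 - h ≤ ⟪(w : RSpace d), z⟫}.indicator (fun _ => 1) z

theorem measurable_capIndicator (h : ℝ) (w : Theta d) : Measurable (capIndicator h w) :=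
  measurable_const.indicator (isClosed_le continuous_const (by fun_prop)).measurableSet

theorem capIndicator_nonneg (h : ℝ) (w : Theta d) (z : RSpace d) : 0 ≤ capIndicator h w z :=
  Set.indicator_nonneg (fun _ _ => zero_le_one) z

theorem capIndicator_le_one (h : ℝ) (w : Theta d) (z : RSpace d) : capIndicator h w z ≤ 1 :=
  Set.indicator_le' (fun _ _ => le_rfl) (fun _ _ => zero_le_one) z

theorem integral_capIndicator (h : ℝ) (w : Theta d) :
    ∫ v : Theta d, capIndicator h w v ∂surfaceArea d = (surfaceArea d).real (sphericalCap w h) := by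
  rw [← integral_indicator_one (measurableSet_sphericalCap w h)]
  rfl

/-- The weight vanishes outside a cap of radius √(2h) → 0, where the uniformly continuous ψ hardly
varies. -/
theorem eventually_abs_integral_kernelWeight_mul_sub_le (hK : Continuous K) (hK1 : K 1 = 0)
    {ψ : Theta d → ℝ} (hψ : Continuous ψ) (hh01 : ∀ n, 0 < h n ∧ h n < 1)
    (hh : Tendsto h atTop (𝓝 0)) (w₀ : Theta d) {ε : ℝ} (hε : 0 < ε) :
    ∀ᶠ n in atTop, ∀ w : Theta d,
      |∫ v : Theta d, kernelWeight K (h n) w v * ψ v ∂surfaceArea d -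
        ψ w * (kernelConst (h n) K w₀)⁻¹| ≤ ε * (kernelConst (h n) K w₀)⁻¹ := by
  obtain ⟨δ, hδ, hψδ⟩ := Metric.uniformContinuous_iff.1
    (CompactSpace.uniformContinuous_of_continuous hψ) ε hε
  have hlim : Tendsto (fun n => √(2 * h n)) atTop (𝓝 0) := by
    have := (hh.const_mul 2).sqrt
    simpa using this
  filter_upwards [hlim.eventually_lt_const hδ] with n hn w
  have hh0 := (hh01 n).1
  have hki : Integrable (fun v : Theta d => kernelWeight K (h n) w v) (surfaceArea d) :=
    integrable_kernelWeight hK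
  have hkc : Continuous fun v : Theta d => kernelWeight K (h n) w v :=
    (continuous_kernelWeight hK).comp continuous_subtype_val
  have hkψ : Integrable (fun v : Theta d => kernelWeight K (h n) w v * ψ v) (surfaceArea d) :=
    integrable_theta (hkc.mul hψ)
  rw [← integral_kernelWeight_eq_inv hK1 hh0 w w₀, ← integral_const_mul, ← integral_const_mul,
    ← integral_sub hkψ (hki.const_mul _), ← Real.norm_eq_abs]
  refine norm_integral_le_of_norm_le (hki.const_mul _) (ae_of_all _ fun v => ?_)
  rw [mul_comm (ψ w), ← mul_sub, norm_mul, Real.norm_of_nonneg (kernelWeight_nonneg _), mul_comm]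
  by_cases hv : v ∈ sphericalCap w (h n)
  · refine mul_le_mul_of_nonneg_right ?_ (kernelWeight_nonneg _)
    have h1 := (mem_sphericalCap_iff hh0.le).1 hv
    have h2 := hψδ (a := v) (b := w) (h1.trans_lt hn)
    rw [Real.dist_eq] at h2
    exact h2.le
  · simp [kernelWeight_eq_zero hK1 hh0 hv]

/-- The mean of a kernel sum of exceedances is asymptotic to the spectral density. -/
theorem DensityRegularVariation.eventually_abs_mean_sub_le (hd : 1 ≤ d)
    (hf : DensityRegularVariation f α q V) (hK : Continuous K) (hKa : Antitone K) (hK0 : K 0 = 1)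
    (hK1 : K 1 = 0)
    (hh01 : ∀ n, 0 < h n ∧ h n < 1) (hh : Tendsto h atTop (𝓝 0)) (w₀ : Theta d) (hθ : 0 < θ)
    (hs : Tendsto s atTop atTop)
    (hsk : ∀ᶠ n in atTop, n * (densityMeasure f).real {z | s n < ‖z‖} = θ * k n)
    {ε : ℝ} (hε : 0 < ε) :
    ∀ᶠ n in atTop, ∀ w : Theta d,
      |n * ∫ z, exceedance (kernelWeight K (h n) w) (s n) z ∂densityMeasure f -
        θ * normalizedLimit q w * (k n / kernelConst (h n) K w₀)| ≤
      ε * (k n / kernelConst (h n) K w₀) := by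
  -- Two errors of size η θ k / c are added: one from the law of the direction beyond the threshold,
  -- one from kernel smoothing.
  set η := ε / (2 * θ)
  have hη : 0 < η := by positivity
  filter_upwards [hs.eventually (hf.eventually_abs_setIntegral_direction_sub_le hd hη), hsk,
    eventually_abs_integral_kernelWeight_mul_sub_le hK hK1 hf.continuous_normalizedLimit hh01 hh w₀
      hη] with n h1 h2 h3 w
  have h1 := h1 (kernelWeight K (h n) w) (continuous_kernelWeight hK).measurable
    kernelWeight_nonneg kernelWeight_le_one
  have h3 := h3 w
  rw [integral_exceedance]
  have hI := integral_kernelWeight_pos (d := d) hK hKa hK0 (hh01 n).1 w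
  rw [integral_kernelWeight_eq_inv hK1 (hh01 n).1 w w₀] at h1 hI
  set I := (kernelConst (h n) K w₀)⁻¹
  set G := (densityMeasure f).real {z | s n < ‖z‖}
  set J := ∫ v : Theta d, kernelWeight K (h n) w v * normalizedLimit q v ∂surfaceArea d
  set E := ∫ z in {z | s n < ‖z‖}, kernelWeight K (h n) w (‖z‖⁻¹ • z) ∂densityMeasure f
  have h4 : |n * E - θ * k n * J| ≤ η * (θ * k n) * I := by
    rw [← h2, mul_assoc, ← mul_sub, abs_mul, Nat.abs_cast]
    calc _ ≤ (n : ℝ) * (η * G * I) := by gcongr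
      _ = _ := by ring
  have h5 : |θ * k n * J - θ * k n * (normalizedLimit q w * I)| ≤ θ * k n * (η * I) := by
    rw [← mul_sub, abs_mul, abs_of_nonneg (by positivity : 0 ≤ θ * (k n : ℝ))]
    gcongr
  have h6 : η * (θ * k n) * I + θ * k n * (η * I) = ε * (k n / kernelConst (h n) K w₀) := by
    rw [div_eq_mul_inv]
    change _ = ε * (k n * I)
    simp only [η]
    field_simp
    ring
  rw [← h6, div_eq_mul_inv]
  change |_ - θ * _ * (k n * I)| ≤ _
  rw [show n * E - θ * normalizedLimit q w * (k n * I) =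
    (n * E - θ * k n * J) + (θ * k n * J - θ * k n * (normalizedLimit q w * I)) by ring]
  exact (abs_add_le _ _).trans (add_le_add h4 h5)

/-- The direction has a bounded limit density and the area of the cap of height 2h is O(1 / c), so
the mean count has the order k / c. It controls the oscillation of kernel sums between grid points.
-/
theorem DensityRegularVariation.exists_eventually_cap_mean_le (hd : 1 ≤ d)
    (hf : DensityRegularVariation f α q V) (hK : Continuous K) (hKa : Antitone K) (hK0 : K 0 = 1)
    (hK1 : K 1 = 0) (hh01 : ∀ n, 0 < h n ∧ h n < 1) (w₀ : Theta d) (hθ : 0 < θ)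
    (hs : Tendsto s atTop atTop)
    (hsk : ∀ᶠ n in atTop, n * (densityMeasure f).real {z | s n < ‖z‖} = θ * k n) :
    ∃ B, 0 < B ∧ ∀ᶠ n in atTop, ∀ w : Theta d,
      n * ∫ z, exceedance (capIndicator (2 * h n) w) (s n) z ∂densityMeasure f ≤
        B * (k n / kernelConst (h n) K w₀) := by
  obtain ⟨D, hD, hcap⟩ := exists_measureReal_sphericalCap_le_integral_kernelWeight (d := d) hK hKa
    hK0
  obtain ⟨M, hM⟩ := isCompact_univ.exists_bound_of_continuousOn
    hf.continuous_normalizedLimit.continuousOn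
  have hM' : ∀ v, normalizedLimit q v ≤ |M| := fun v =>
    (le_abs_self _).trans ((hM v trivial).trans (le_abs_self _))
  refine ⟨θ * (|M| + 1) * D, by positivity, ?_⟩
  filter_upwards [hs.eventually (hf.eventually_abs_setIntegral_direction_sub_le hd one_pos), hsk]
    with n h1 h2 w
  have h1 := h1 (capIndicator (2 * h n) w) (measurable_capIndicator _ _)
    (capIndicator_nonneg _ _) (capIndicator_le_one _ _)
  have h3 := hcap (h n) w (hh01 n).1
  rw [integral_kernelWeight_eq_inv hK1 (hh01 n).1 w w₀] at h3
  have hm : Measurable fun v : Theta d => capIndicator (2 * h n) w v :=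
    (measurable_capIndicator _ _).comp measurable_subtype_coe
  have hi : Integrable (fun v : Theta d => capIndicator (2 * h n) w v) (surfaceArea d) :=
    Integrable.of_bound hm.aestronglyMeasurable 1 (ae_of_all _ fun v => by
      rw [Real.norm_of_nonneg (capIndicator_nonneg _ _ _)]
      exact capIndicator_le_one _ _ _)
  have h4 : ∫ v : Theta d, capIndicator (2 * h n) w v * normalizedLimit q v ∂surfaceArea d ≤
      |M| * (surfaceArea d).real (sphericalCap w (2 * h n)) := by
    rw [← integral_capIndicator, ← integral_const_mul]
    refine integral_mono_of_nonneg (ae_of_all _ fun v => mul_nonneg (capIndicator_nonneg _ _ _)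
      (hf.normalizedLimit_pos hd v).le) (hi.const_mul _) (ae_of_all _ fun v => ?_)
    change _ * _ ≤ _ * _
    rw [mul_comm]
    exact mul_le_mul_of_nonneg_right (hM' v) (capIndicator_nonneg _ _ _)
  rw [integral_exceedance]
  rw [integral_capIndicator] at h1
  set I := (kernelConst (h n) K w₀)⁻¹
  set G := (densityMeasure f).real {z | s n < ‖z‖}
  set L := (surfaceArea d).real (sphericalCap w (2 * h n))
  set E := ∫ z in {z | s n < ‖z‖}, capIndicator (2 * h n) w (‖z‖⁻¹ • z) ∂densityMeasure f
  set J := ∫ v : Theta d, capIndicator (2 * h n) w v * normalizedLimit q v ∂surfaceArea d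
  have hG : 0 ≤ G := measureReal_nonneg
  have h5 : E ≤ G * ((|M| + 1) * L) := by
    have := (abs_le.1 h1).2
    have h6 : G * J ≤ G * (|M| * L) := by gcongr
    linarith
  calc (n : ℝ) * E ≤ n * (G * ((|M| + 1) * L)) := by gcongr
    _ = θ * k n * ((|M| + 1) * L) := by rw [← mul_assoc, h2]
    _ ≤ θ * k n * ((|M| + 1) * (D * I)) := by gcongr
    _ = _ := by rw [div_eq_mul_inv]; ring

end Mean

/-! ### Uniform consistency over a deterministic threshold. -/

section Uniform

variable {d : ℕ} {f q : RSpace d → ℝ} {α : ℝ} {V : ℝ → ℝ} [IsProbabilityMeasure (densityMeasure f)]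
  {K : unitInterval → unitInterval} {k : ℕ → ℕ} {h s : ℕ → ℝ} {θ : ℝ}
  {Ω : Type*} [MeasurableSpace Ω] {P : Measure Ω} [IsProbabilityMeasure P]
  {X : ℕ → Ω → RSpace d}

/-- The oscillation of the kernel weight in its centre is controlled by the indicator of a cap. -/
theorem abs_exceedance_kernelWeight_sub_le (hK1 : K 1 = 0) {δ ε : ℝ} (hδ1 : δ ≤ 1)
    (hosc : ∀ u u', |u - u'| ≤ δ → |kernelValue K u - kernelValue K u'| ≤ ε)
    {h : ℝ} (hh : 0 < h) {s : ℝ} (hs : 0 ≤ s) {w y : Theta d} (hwy : dist w y ≤ δ * h)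
    (z : RSpace d) :
    |exceedance (kernelWeight K h w) s z - exceedance (kernelWeight K h y) s z| ≤
      ε * exceedance (capIndicator (2 * h) y) s z := by
  by_cases hz : s < ‖z‖
  swap
  · simp [exceedance, hz]
  simp only [exceedance, Set.indicator_of_mem (show z ∈ {z : RSpace d | s < ‖z‖} from hz)]
  have hz0 : ‖z‖ ≠ 0 := (hs.trans_lt hz).ne'
  set u := ‖z‖⁻¹ • z
  have hu : ‖u‖ = 1 := by simp [u, norm_smul, hz0]
  have hin : |⟪(w : RSpace d), u⟫ - ⟪(y : RSpace d), u⟫| ≤ δ * h := by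
    rw [← inner_sub_left]
    refine (abs_real_inner_le_norm _ _).trans ?_
    rwa [hu, mul_one, ← dist_eq_norm, ← Subtype.dist_eq]
  -- Outside the cap of height 2h about y, moving the centre by at most δ h ≤ h keeps u outside the
  -- cap of height h about w, and both weights vanish.
  by_cases hc : 1 - 2 * h ≤ ⟪(y : RSpace d), u⟫
  · have : capIndicator (2 * h) y u = 1 := Set.indicator_of_mem (show u ∈ {z : RSpace d |
      1 - 2 * h ≤ ⟪(y : RSpace d), z⟫} from hc) _
    rw [this, mul_one]
    refine hosc _ _ ?_
    rw [← sub_div, abs_div, abs_of_pos hh, div_le_iff₀ hh, sub_sub_sub_cancel_left, abs_sub_comm]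
    exact hin
  · have h0 : capIndicator (2 * h) y u = 0 := Set.indicator_of_notMem (show u ∉ {z : RSpace d |
      1 - 2 * h ≤ ⟪(y : RSpace d), z⟫} from hc) _
    have h1 : δ * h ≤ h := by nlinarith
    have h2 := (abs_le.1 hin).2
    push Not at hc
    have hy : kernelWeight K h y u = 0 := kernelValue_of_one_le hK1 (by
      rw [le_div_iff₀ hh]; linarith)
    have hw : kernelWeight K h w u = 0 := kernelValue_of_one_le hK1 (by
      rw [le_div_iff₀ hh]; linarith)
    rw [h0, hy, hw]
    simp

/-- Uniform consistency of kernel sums over the exceedances of a deterministic threshold. -/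
theorem DensityRegularVariation.tendsto_measureReal_exists_abs_sum_sub_gt (hd : 1 ≤ d)
    (hf : DensityRegularVariation f α q V) (hX : ∀ i, Measurable (X i)) (hind : iIndepFun X P)
    (hlaw : ∀ i, P.map (X i) = densityMeasure f) (hk : Tendsto k atTop atTop)
    (hK : Continuous K) (hKa : Antitone K) (hK0 : K 0 = 1) (hK1 : K 1 = 0)
    (hh01 : ∀ n, 0 < h n ∧ h n < 1) (hh : Tendsto h atTop (𝓝 0)) (w₀ : Theta d)
    (hkc : Tendsto (fun n => (k n : ℝ) / (kernelConst (h n) K w₀ * Real.log (k n))) atTop atTop)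
    (hθ : 0 < θ) (hs0 : ∀ n, 0 ≤ s n) (hs : Tendsto s atTop atTop)
    (hsk : ∀ᶠ n in atTop, n * (densityMeasure f).real {z | s n < ‖z‖} = θ * k n)
    {ε : ℝ} (hε : 0 < ε) :
    Tendsto (fun n => P.real {ω | ∃ w : Theta d, ε * (k n / kernelConst (h n) K w₀) <
      |∑ i : Fin n, exceedance (kernelWeight K (h n) w) (s n) (X i ω) -
        θ * normalizedLimit q w * (k n / kernelConst (h n) K w₀)|}) atTop (𝓝 0) := by
  set ψ : Theta d → ℝ := normalizedLimit q
  set c : ℕ → ℝ := fun n => kernelConst (h n) K w₀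
  set m : ℕ → ℝ := fun n => k n / c n
  have hc : ∀ n, 0 < c n := fun n => by
    simp only [c]
    rw [kernelConst_eq_inv_integral hK1 (hh01 n).1, inv_pos]
    exact integral_kernelWeight_pos hK hKa hK0 (hh01 n).1 w₀
  have hm : ∀ n, 0 ≤ m n := fun n => div_nonneg (Nat.cast_nonneg _) (hc n).le
  obtain ⟨B, hB, hcap⟩ := hf.exists_eventually_cap_mean_le hd hK hKa hK0 hK1 hh01 w₀ hθ hs hsk
  obtain ⟨M, hM⟩ := isCompact_univ.exists_bound_of_continuousOn
    hf.continuous_normalizedLimit.continuousOn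
  have hψM : ∀ v, ψ v ≤ |M| := fun v => (le_abs_self _).trans ((hM v trivial).trans (le_abs_self _))
  -- Cap counts will be at most (B + 1) m, so the oscillation error is at most ε m / 5.
  set ε₁ := ε / (5 * (B + 1))
  have hε₁ : 0 < ε₁ := by positivity
  have hε5 : 0 < ε / 5 := by positivity
  obtain ⟨δ, hδ, hδ1, hosc⟩ : ∃ δ, 0 < δ ∧ δ ≤ 1 ∧
      ∀ u u', |u - u'| ≤ δ → |kernelValue K u - kernelValue K u'| ≤ ε₁ := by
    obtain ⟨δ, hδ, h⟩ := Metric.uniformContinuous_iff.1 (uniformContinuous_kernelValue hK) ε₁ hε₁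
    refine ⟨min (δ / 2) 1, by positivity, min_le_right _ _, fun u u' hu => (h ?_).le⟩
    rw [Real.dist_eq]
    exact (hu.trans (min_le_left _ _)).trans_lt (by linarith)
  obtain ⟨ρ, hρ, hψρ⟩ := Metric.uniformContinuous_iff.1
    (CompactSpace.uniformContinuous_of_continuous hf.continuous_normalizedLimit) (ε / (5 * θ))
    (by positivity)
  obtain ⟨C, hC, hgrid⟩ := exists_grid hd hK hKa hK0 hK1 hδ
  obtain ⟨κ₁, hκ₁, hconc₁⟩ := exists_exceedance_concentration (P := P) hX hind hlaw hε5
    (by positivity : 0 < θ * |M| + ε / 5)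
  obtain ⟨κ₂, hκ₂, hconc₂⟩ := exists_exceedance_concentration (P := P) hX hind hlaw one_pos hB
  have hrate := ((tendsto_pow_mul_exp_neg hk hc hkc (2 * d) hκ₁).add
    (tendsto_pow_mul_exp_neg hk hc hkc (2 * d) hκ₂)).const_mul (C * 2)
  rw [add_zero, mul_zero] at hrate
  refine squeeze_zero' (Eventually.of_forall fun n => measureReal_nonneg) ?_ hrate
  filter_upwards [hf.eventually_abs_mean_sub_le hd hK hKa hK0 hK1 hh01 hh w₀ hθ hs hsk hε5, hcap,
    hh.eventually_lt_const hρ] with n hmean hcapn hhρ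
  obtain ⟨hn0, hn1⟩ := hh01 n
  obtain ⟨F, hF, hcov⟩ := hgrid (h n) w₀ hn0 hn1
  set p : Theta d → ℝ := fun y => n * ∫ z, exceedance (kernelWeight K (h n) y) (s n) z
    ∂densityMeasure f
  set p' : Theta d → ℝ := fun y => n * ∫ z, exceedance (capIndicator (2 * h n) y) (s n) z
    ∂densityMeasure f
  set S : Theta d → Ω → ℝ := fun y ω =>
    ∑ i : Fin n, exceedance (kernelWeight K (h n) y) (s n) (X i ω)
  set T : Theta d → Ω → ℝ := fun y ω =>
    ∑ i : Fin n, exceedance (capIndicator (2 * h n) y) (s n) (X i ω)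
  -- Off the bad events at grid points, four errors of at most ε m / 5 remain: oscillation of the
  -- kernel, fluctuation at y, bias at y, and oscillation of ψ.
  have hsub : {ω | ∃ w : Theta d, ε * m n < |S w ω - θ * ψ w * m n|} ⊆
      ⋃ y ∈ F, ({ω | ε / 5 * m n ≤ |S y ω - p y|} ∪ {ω | 1 * m n ≤ |T y ω - p' y|}) := by
    rintro ω ⟨w, hw⟩
    by_contra hcon
    simp only [Set.mem_iUnion, Set.mem_union, Set.mem_ofPred_eq, not_exists, not_or, not_le] at hcon
    obtain ⟨y, hyF, hwy⟩ := hcov w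
    obtain ⟨h1, h2⟩ := hcon y hyF
    have h3 : |S w ω - S y ω| ≤ ε₁ * T y ω := by
      simp only [S, T]
      rw [← Finset.sum_sub_distrib, Finset.mul_sum]
      exact (Finset.abs_sum_le_sum_abs _ _).trans (Finset.sum_le_sum fun i _ =>
        abs_exceedance_kernelWeight_sub_le hK1 hδ1 hosc hn0 (hs0 n) hwy _)
    have h4 : T y ω ≤ (B + 1) * m n := by
      have := (abs_lt.1 h2).2
      have := hcapn y
      change p' y ≤ B * m n at this
      linarith
    have h5 : ε₁ * T y ω ≤ ε / 5 * m n := by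
      calc ε₁ * T y ω ≤ ε₁ * ((B + 1) * m n) := by gcongr
        _ = ε / 5 * m n := by simp only [ε₁]; field_simp
    have h6 : |p y - θ * ψ y * m n| ≤ ε / 5 * m n := hmean y
    have h7 : |θ * ψ y * m n - θ * ψ w * m n| ≤ ε / 5 * m n := by
      have hlt : dist y w < ρ := by
        rw [dist_comm]
        refine hwy.trans_lt (lt_of_le_of_lt ?_ hhρ)
        nlinarith
      have h8 := (hψρ hlt).le
      rw [Real.dist_eq] at h8
      rw [← sub_mul, ← mul_sub, abs_mul, abs_mul, abs_of_pos hθ, abs_of_nonneg (hm n)]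
      refine mul_le_mul_of_nonneg_right ?_ (hm n)
      calc θ * |ψ y - ψ w| ≤ θ * (ε / (5 * θ)) := by gcongr
        _ = ε / 5 := by field_simp
    have hmn := mul_nonneg hε.le (hm n)
    have h9 : |S w ω - θ * ψ w * m n| ≤ |S w ω - S y ω| + |S y ω - p y| +
        |p y - θ * ψ y * m n| + |θ * ψ y * m n - θ * ψ w * m n| := by
      rw [show S w ω - θ * ψ w * m n = (S w ω - S y ω) + (S y ω - p y) +
        (p y - θ * ψ y * m n) + (θ * ψ y * m n - θ * ψ w * m n) by ring]
      exact (abs_add_le _ _).trans (add_le_add (abs_add_three _ _ _) le_rfl)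
    linarith
  have hpB : ∀ y, p y ≤ (θ * |M| + ε / 5) * m n := fun y => by
    have h1 := (abs_le.1 (hmean y)).2
    change p y - θ * ψ y * m n ≤ ε / 5 * m n at h1
    have h2 : θ * ψ y * m n ≤ θ * |M| * m n := by
      have := hm n
      gcongr
      exact hψM y
    linarith
  calc _ ≤ P.real (⋃ y ∈ F, ({ω | ε / 5 * m n ≤ |S y ω - p y|} ∪
        {ω | 1 * m n ≤ |T y ω - p' y|})) := measureReal_mono hsub (measure_ne_top _ _)
    _ ≤ ∑ y ∈ F, P.real ({ω | ε / 5 * m n ≤ |S y ω - p y|} ∪ {ω | 1 * m n ≤ |T y ω - p' y|}) :=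
        measureReal_biUnion_finset_le _ _
    _ ≤ ∑ y ∈ F, (2 * Real.exp (-(κ₁ * m n)) + 2 * Real.exp (-(κ₂ * m n))) := by
        refine Finset.sum_le_sum fun y _ => (measureReal_union_le _ _).trans (add_le_add ?_ ?_)
        · exact hconc₁ _ _ _ _ (continuous_kernelWeight hK).measurable kernelWeight_nonneg
            kernelWeight_le_one (hm n) (hpB y)
        · exact hconc₂ _ _ _ _ (measurable_capIndicator _ _) (capIndicator_nonneg _ _)
            (capIndicator_le_one _ _) (hm n) (hcapn y)
    _ = F.card * (2 * Real.exp (-(κ₁ * m n)) + 2 * Real.exp (-(κ₂ * m n))) := by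
        rw [Finset.sum_const, nsmul_eq_mul]
    _ ≤ C * c n ^ (2 * d) * (2 * Real.exp (-(κ₁ * m n)) + 2 * Real.exp (-(κ₂ * m n))) := by
        gcongr
    _ = _ := by ring

end Uniform

/-! ### Concentration of the number of exceedances. -/

section Count

variable {d : ℕ} {f : RSpace d → ℝ} {k : ℕ → ℕ} {s : ℕ → ℝ} {θ : ℝ}
  {Ω : Type*} [MeasurableSpace Ω] {P : Measure Ω} [IsProbabilityMeasure P]
  {X : ℕ → Ω → RSpace d}

/-- Concentration of the number of exceedances of a deterministic threshold. -/
theorem tendsto_measureReal_abs_card_sub_ge (hX : ∀ i, Measurable (X i)) (hind : iIndepFun X P)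
    (hlaw : ∀ i, P.map (X i) = densityMeasure f) (hk : Tendsto k atTop atTop) (hθ : 0 < θ)
    (hsk : ∀ᶠ n in atTop, n * (densityMeasure f).real {z | s n < ‖z‖} = θ * k n)
    {ε : ℝ} (hε : 0 < ε) :
    Tendsto (fun n => P.real {ω | ε * k n ≤
      |((Finset.univ.filter fun i : Fin n => s n < ‖X i ω‖).card : ℝ) - θ * k n|})
      atTop (𝓝 0) := by
  obtain ⟨κ, hκ, hconc⟩ := exists_exceedance_concentration (P := P) hX hind hlaw hε hθ
  have hkr : Tendsto (fun n => (k n : ℝ)) atTop atTop := tendsto_natCast_atTop_atTop.comp hk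
  have hlim : Tendsto (fun n => 2 * Real.exp (-(κ * k n))) atTop (𝓝 0) := by
    have := (Real.tendsto_exp_neg_atTop_nhds_zero.comp (hkr.const_mul_atTop hκ)).const_mul 2
    simpa using this
  refine squeeze_zero' (Eventually.of_forall fun n => measureReal_nonneg) ?_ hlim
  filter_upwards [hsk] with n hn
  have hp : n * ∫ z, exceedance (fun _ => 1) (s n) z ∂densityMeasure f = θ * k n := by
    rw [integral_exceedance, ← hn]
    simp
  have hcard : ∀ ω, ∑ i : Fin n, exceedance (fun _ => 1) (s n) (X i ω) =
      ((Finset.univ.filter fun i : Fin n => s n < ‖X i ω‖).card : ℝ) := fun ω => by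
    simp [exceedance, Set.indicator_apply, Finset.sum_boole]
  have := hconc (fun _ => 1) (s n) (k n) n measurable_const (fun _ => zero_le_one)
    (fun _ => le_rfl) (Nat.cast_nonneg _) hp.le
  simpa only [hp, hcard] using this

end Count

/-! ### The estimator at the random threshold. -/

theorem spectralEstimator_eq {d n : ℕ} (k : ℕ) (h : ℝ) (K : unitInterval → unitInterval)
    (x : Fin n → RSpace d) (w : Theta d) :
    spectralEstimator k h K x w = kernelConst h K w / k * ∑ i, exceedance (kernelWeight K h w)
      (orderStatistic (fun j => ‖x j‖) (n - k)) (x i) := by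
  unfold spectralEstimator
  congr 1
  refine Finset.sum_congr rfl fun i _ => ?_
  simp only [exceedance, Set.indicator_apply, Set.mem_ofPred_eq, kernelWeight, mul_ite, mul_one,
    mul_zero]

theorem proposition2
    {Ω : Type*} [MeasurableSpace Ω] (P : Measure Ω) [IsProbabilityMeasure P]
    (d : ℕ) (hd : 1 ≤ d)
    -- an i.i.d. sequence of random vectors in `ℝᵈ` with density `f`
    (X : ℕ → Ω → RSpace d) (hX : ∀ i, Measurable (X i)) (hindep : iIndepFun X P)
    (f : RSpace d → ℝ)
    (hlaw : ∀ i, P.map (X i) = volume.withDensity fun z => ENNReal.ofReal (f z))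
    -- regular variation of the density
    (α : ℝ) (hα : 0 < α) (q : RSpace d → ℝ) (V : ℝ → ℝ)
    (hf : DensityRegularVariation f α q V)
    -- the number of upper order statistics
    (k : ℕ → ℕ) (hk : Tendsto k atTop atTop)
    (hkn : Tendsto (fun n => (k n : ℝ) / n) atTop (𝓝 0))
    -- the kernel and the bandwidth
    (K : unitInterval → unitInterval) (hKcont : Continuous K) (hKanti : Antitone K)
    (hK0 : K 0 = 1) (hK1 : K 1 = 0)
    (h : ℕ → ℝ) (hh01 : ∀ n, 0 < h n ∧ h n < 1) (hh : Tendsto h atTop (𝓝 0))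
    (hkc : ∀ w : Theta d,
      Tendsto (fun n => (k n : ℝ) / (kernelConst (h n) K w * Real.log (k n))) atTop atTop) :
    -- the spectral density exists, and the estimator is uniformly consistent for it
    (∃ ψ : Theta d → ℝ, IsSpectralDensity (P.map (X 0)) f α ψ) ∧
    ∀ ψ : Theta d → ℝ, IsSpectralDensity (P.map (X 0)) f α ψ →
      ∀ ε : ℝ, 0 < ε →
        Tendsto (fun n : ℕ => P {ω | ENNReal.ofReal ε <
            ⨆ w : Theta d, ENNReal.ofReal
              |spectralEstimator (k n) (h n) K (fun i : Fin n => X i ω) w - ψ w|})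
          atTop (𝓝 0) := by
  have hlaw' : ∀ i, P.map (X i) = densityMeasure f := hlaw
  have : IsProbabilityMeasure (densityMeasure f) := by
    rw [← hlaw' 0]
    exact Measure.isProbabilityMeasure_map (hX 0).aemeasurable
  rw [hlaw' 0]
  refine ⟨⟨_, hf.isSpectralDensity hd hα⟩, fun ψ hψ ε hε => ?_⟩
  obtain rfl := hψ.eq hα.ne' (hf.isSpectralDensity hd hα)
  set ψ : Theta d → ℝ := normalizedLimit q
  let w₀ : Theta d := ⟨EuclideanSpace.single ⟨0, by omega⟩ 1, by simp⟩
  obtain ⟨M, hM⟩ := isCompact_univ.exists_bound_of_continuousOn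
    hf.continuous_normalizedLimit.continuousOn
  have hψM : ∀ v, ψ v ≤ |M| := fun v => (le_abs_self _).trans ((hM v trivial).trans (le_abs_self _))
  have hψ0 : ∀ v, 0 ≤ ψ v := fun v => (hf.normalizedLimit_pos hd v).le
  -- The threshold perturbation costs a bias η ψ, kept below ε / 4; η ≤ 1/2 keeps 1 - η positive.
  obtain ⟨η, hη, hη1, hηM⟩ : ∃ η : ℝ, 0 < η ∧ η ≤ 1 / 2 ∧ η * |M| ≤ ε / 4 := by
    refine ⟨min (1 / 2) (ε / (4 * (|M| + 1))), by positivity, min_le_left _ _, ?_⟩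
    calc _ ≤ ε / (4 * (|M| + 1)) * |M| := by gcongr; exact min_le_right _ _
      _ = ε / 4 * (|M| / (|M| + 1)) := by field_simp
      _ ≤ ε / 4 * 1 := by gcongr; exact (div_le_one (by positivity)).2 (by linarith)
      _ = ε / 4 := mul_one _
  have hkpos : ∀ᶠ n in atTop, 0 < k n := hk.eventually_gt_atTop 0
  have hthr : ∀ θ : ℝ, 0 < θ → ∃ s : ℕ → ℝ, (∀ n, 0 ≤ s n) ∧ Tendsto s atTop atTop ∧
      ∀ᶠ n in atTop, n * (densityMeasure f).real {z | s n < ‖z‖} = θ * k n := by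
    intro θ hθ
    obtain ⟨s, h1, h2, h3⟩ := hf.exists_threshold hd (p := fun n => θ * ((k n : ℝ) / n)) (by
        filter_upwards [hkpos, eventually_gt_atTop 0] with n h1 h2
        positivity) (by simpa using hkn.const_mul θ)
    refine ⟨s, h1, h2, ?_⟩
    filter_upwards [h3, eventually_gt_atTop 0] with n h3 h4
    rw [h3]
    field_simp
  -- The threshold s has (1 + η) k expected exceedances and s' has (1 - η) k. Deviations below η k
  -- leave more than k exceedances of s and fewer than k of s'.
  obtain ⟨s, hs0, hs, hsk⟩ := hthr (1 + η) (by linarith)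
  obtain ⟨s', hs0', hs', hsk'⟩ := hthr (1 - η) (by linarith)
  have hU := hf.tendsto_measureReal_exists_abs_sum_sub_gt hd hX hindep hlaw' hk hKcont hKanti hK0
    hK1 hh01 hh w₀ (hkc w₀) (by linarith) hs0 hs hsk (ε := ε / 4) (by positivity)
  have hU' := hf.tendsto_measureReal_exists_abs_sum_sub_gt hd hX hindep hlaw' hk hKcont hKanti hK0
    hK1 hh01 hh w₀ (hkc w₀) (by linarith) hs0' hs' hsk' (ε := ε / 4) (by positivity)
  have hC := tendsto_measureReal_abs_card_sub_ge hX hindep hlaw' hk (by linarith) hsk hη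
  have hC' := tendsto_measureReal_abs_card_sub_ge hX hindep hlaw' hk (by linarith) hsk' hη
  have hsum := (hU.add hU').add (hC.add hC')
  simp only [add_zero] at hsum
  rw [← ENNReal.tendsto_toReal_iff (fun n => measure_ne_top _ _) (by simp), ENNReal.toReal_zero]
  refine squeeze_zero' (Eventually.of_forall fun n => ENNReal.toReal_nonneg) ?_ hsum
  have hkn1 : ∀ᶠ n in atTop, k n < n := by
    filter_upwards [hkn.eventually_lt_const one_pos, eventually_gt_atTop 0] with n h1 h2
    rw [div_lt_one (by positivity)] at h1
    exact_mod_cast h1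
  filter_upwards [hkpos, hkn1] with n hk0 hkn1
  have hkr : (0 : ℝ) < k n := Nat.cast_pos.2 hk0
  have hh0 := (hh01 n).1
  have hc : 0 < kernelConst (h n) K w₀ := by
    rw [kernelConst_eq_inv_integral hK1 hh0, inv_pos]
    exact integral_kernelWeight_pos hKcont hKanti hK0 hh0 w₀
  set m : ℝ := k n / kernelConst (h n) K w₀ with hm_def
  have hm : 0 < m := by positivity
  refine le_trans (measureReal_mono (μ := P) (fun ω hω => ?_) (measure_ne_top _ _))
    ((measureReal_union_le _ _).trans (add_le_add (measureReal_union_le _ _)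
      (measureReal_union_le _ _)))
  by_contra hcon
  simp only [Set.mem_union, Set.mem_ofPred_eq, not_or, not_exists, not_lt, not_le] at hcon
  obtain ⟨⟨h1, h2⟩, h3, h4⟩ := hcon
  refine absurd (show ENNReal.ofReal ε < _ from hω) (not_lt.2 (iSup_le fun w => ?_))
  refine ENNReal.ofReal_le_ofReal ?_
  have hlo : s n ≤ orderStatistic (fun j : Fin n => ‖X j ω‖) (n - k n) := by
    refine le_orderStatistic_of_lt_card hkn1 ?_
    rw [← Nat.cast_lt (α := ℝ)]
    linarith [(abs_lt.1 h3).1]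
  have hup : orderStatistic (fun j : Fin n => ‖X j ω‖) (n - k n) ≤ s' n := by
    refine orderStatistic_le_of_card_le hkn1 ?_
    rw [← Nat.cast_le (α := ℝ)]
    linarith [(abs_lt.1 h4).2]
  rw [spectralEstimator_eq, kernelConst_eq (h n) K w w₀,
    show kernelConst (h n) K w₀ / k n = m⁻¹ by rw [hm_def, inv_div]]
  set S := ∑ i : Fin n, exceedance (kernelWeight K (h n) w)
    (orderStatistic (fun j : Fin n => ‖X j ω‖) (n - k n)) (X i ω)
  -- The weights are nonnegative, so kernel sums decrease in the threshold, and S lies between those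
  -- at s' and s. Fluctuation and bias are each at most ε m / 4.
  have hS1 : S ≤ _ := Finset.sum_le_sum fun i _ =>
    exceedance_anti (kernelWeight_nonneg (K := K) (h := h n) (w := w)) hlo (X i ω)
  have hS2 : _ ≤ S := Finset.sum_le_sum fun i _ =>
    exceedance_anti (kernelWeight_nonneg (K := K) (h := h n) (w := w)) hup (X i ω)
  have h1w := (abs_le.1 (h1 w)).2
  have h2w := (abs_le.1 (h2 w)).1
  have hb : η * ψ w * m ≤ ε / 4 * m := by
    refine mul_le_mul_of_nonneg_right ?_ hm.le
    exact (mul_le_mul_of_nonneg_left (hψM w) hη.le).trans hηM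
  have hεm := mul_pos hε hm
  have hfin : |S - ψ w * m| ≤ ε * m := by
    rw [abs_le]
    constructor <;> linarith
  rw [show m⁻¹ * S - ψ w = (S - ψ w * m) / m by field_simp, abs_div, abs_of_pos hm,
    div_le_iff₀ hm]
  exact hfin
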